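/- **Setting.** Let $E$ be a complete separable metric space and let $A$ be an operator with domain $\mathcal D(A)\subseteq C_b(E)$ whose values $Af$ are Borel measurable real functions on $E$. Let $\Phi:E\to[0,\infty)$ be Borel. For a jointly measurable $E$-valued process $X=(X_t)_{t\ge0}$ put ${}^*\mathcal F^X_t=\sigma\big(X_u,\int_0^u h(X_s)\,ds : u\le t,\ h\in C_b(E)\big)$. For a probability measure $\lambda$ on $E$, a *solution of the $(A,\lambda)$ martingale problem* is a jointly measurable process $X$ on some probability space $(\Omega,\mathcal F,\mathbb P)$ such that $X_0$ has law $\lambda$, $\mathbb E\int_0^T\Phi(X_s)\,ds<\infty$ for all $T<\infty$, and $f(X_t)-\int_0^tAf(X_s)\,ds$ is an $({}^*\mathcal F^X_t)$-martingale for every $f\in\mathcal D(A)$. The $(A,\lambda)$ problem is *well-posed* (in the class of solutions continuous in probability) if a solution that is continuous in probability exists and any two such solutions, possibly on different probability spaces, have the same finite-dimensional distributions. **Assumptions.** - (A1) For every $f\in\mathcal D(A)$ there is $C_f$ with $|Af|\le C_f\Phi$ on $E$. - (A2) There is a countable set $\{f_n\}\subseteq\mathcal D(A)$ such that the closure of $\{(f_n,\Phi^{-1}Af_n)\}$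 under bounded pointwise convergence of sequences contains $\{(f,\Phi^{-1}Af): f\in\mathcal D(A)\}$ (with $\Phi^{-1}Af:=0$ where $\Phi=0$). - (A3) For every $x\in E$ the $(A,\delta_x)$ problem is well-posed in the class of solutions continuous in probability. - (A6) There are Borel functions $h_n:E\to[0,\infty)$, $n\ge1$, such that for every probability measure $\lambda$ on $E$ with $\int h_n\,d\lambda<\infty$ for all $n$, any two solutions of the $(A,\lambda)$ problem that are continuous in probability have the same finite-dimensional distributions. Under (A3), let $\mu_x^m(t_1,\dots,t_m)$, $m\ge1$, be the finite-dimensional distributions of the (unique in law) solution of the $(A,\delta_x)$ problem that is continuous in probability. Let $\Phi^*_N(x)=\int_0^N\int\Phi\,d\mu^1_x(s)\,ds$, let $\mathcal P_\Phi$ be the set of probability measures $\lambda$ on $E$ with $\int\Phi_N^*\,d\lambda<\infty$ for all integers $N\ge1$, and let $T_tf(x)=\int f\,d\mu_x^1(t)$ for bounded Borel $f$. **Theorem.** Assume (A1), (A2), (A3) and (A6). Then the maps $x\mapsto\mu^m_x(t_1,\dots,t_m)$ and $\Phi^*_N$ are Borel measurable, and: (i) For a probability measure $\lambda$ on $E$,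 the $(A,\lambda)$ martingale problem is well-posed in the class of solutions continuous in probability if and only if $\lambda\in\mathcal P_\Phi$. In that case the finite-dimensional distributions of every solution that is continuous in probability are the mixtures $\nu^m(t_1,\dots,t_m)=\int\mu_x^m(t_1,\dots,t_m)\,\lambda(dx)$. (ii) $(T_t)_{t\ge0}$ is a semigroup on the bounded Borel functions on $E$: $T_tf$ is bounded and Borel, $T_0f=f$ and $T_{s+t}f=T_s(T_tf)$. If $\lambda\in\mathcal P_\Phi$ and $X$ is a solution of the $(A,\lambda)$ martingale problem that is continuous in probability, then $X$ is a Markov process with semigroup $(T_t)$: for all $s,t\ge0$ and bounded Borel $f$, $\mathbb E[f(X_{s+t})\mid\sigma(X_u:u\le s)]=T_tf(X_s)$ almost surely. -/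

import Mathlib

open MeasureTheory ProbabilityTheory Filter Topology
open scoped NNReal ENNReal BoundedContinuousFunction

universe u

namespace MartingaleProblem

/-- An operator `A` with domain `𝒟(A)` a set of bounded continuous functions on `E` and values in
the Borel measurable real functions on `E` (not required to be linear). -/
structure MPOperator (E : Type u) [TopologicalSpace E] [MeasurableSpace E] where
  domain : Set (E →ᵇ ℝ)
  toFun : domain → E → ℝ
  measurable_toFun : ∀ f, Measurable (toFun f)

section MeasurableProcesses

variable {E : Type u} [MeasurableSpace E] {Ω : Type u} [MeasurableSpace Ω]

/-- A process `(X_t)_{t ≥ 0}` is measurable if `(t, ω) ↦ X_t(ω)` is jointly measurable. -/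
def MeasurableProcess (X : ℝ≥0 → Ω → E) : Prop :=
  Measurable (Function.uncurry X)

/-- `∫_0^t g(X_s(ω)) ds`. -/
noncomputable def timeIntegral (g : E → ℝ) (X : ℝ≥0 → Ω → E) (t : ℝ≥0) (ω : Ω) : ℝ :=
  ∫ s in Set.Ioc (0 : ℝ) (t : ℝ), g (X s.toNNReal ω)

theorem measurable_timeIntegral {g : E → ℝ} (hg : Measurable g) {X : ℝ≥0 → Ω → E}
    (hX : MeasurableProcess X) (t : ℝ≥0) : Measurable (timeIntegral g X t) := by
  have h : Measurable (Function.uncurry fun (ω : Ω) (s : ℝ) => g (X s.toNNReal ω)) :=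
    hg.comp (hX.comp ((measurable_real_toNNReal.comp measurable_snd).prodMk measurable_fst))
  exact (h.stronglyMeasurable.integral_prod_right
    (ν := volume.restrict (Set.Ioc (0 : ℝ) (t : ℝ)))).measurable

end MeasurableProcesses

section Processes

variable {E : Type u} [MetricSpace E] [MeasurableSpace E] [BorelSpace E]
  {Ω : Type u} [mΩ : MeasurableSpace Ω]

/-- The filtration `σ(X_u, ∫_0^u h(X_s) ds : u ≤ t, h ∈ C_b(E))`. -/
noncomputable def starFiltration (X : ℝ≥0 → Ω → E) (hX : MeasurableProcess X) :
    Filtration ℝ≥0 mΩ where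
  seq t := (⨆ u ≤ t, MeasurableSpace.comap (X u) inferInstance) ⊔
    (⨆ u ≤ t, ⨆ h : E →ᵇ ℝ, MeasurableSpace.comap (timeIntegral h X u) inferInstance)
  mono' := by
    intro s t hst
    exact sup_le_sup
      (iSup₂_le fun v hv => le_iSup₂_of_le v (hv.trans hst) le_rfl)
      (iSup₂_le fun v hv => le_iSup₂_of_le v (hv.trans hst) le_rfl)
  le' := by
    intro t
    refine sup_le (iSup₂_le fun v _ => ?_) (iSup₂_le fun v _ => iSup_le fun h => ?_)
    · exact (hX.comp measurable_prodMk_left : Measurable (X v)).comap_le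
    · exact (measurable_timeIntegral h.continuous.measurable hX v).comap_le

/-- `X`, defined on `(Ω, P)`, is a solution to the martingale problem for `(A, lam)`. -/
structure IsSolution (A : MPOperator E) (Φ : E → ℝ≥0) (lam : Measure E) (P : Measure Ω)
    (X : ℝ≥0 → Ω → E) : Prop where
  measurable : MeasurableProcess X
  law_zero : P.map (X 0) = lam
  integrable : ∀ T : ℝ≥0,
    ∫⁻ ω, (∫⁻ s in Set.Ioc (0 : ℝ) (T : ℝ), (Φ (X s.toNNReal ω) : ℝ≥0∞)) ∂P < ∞
  martingale : ∀ f : A.domain,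
    Martingale (fun t ω => (f : E →ᵇ ℝ) (X t ω) - timeIntegral (A.toFun f) X t ω)
      (starFiltration X measurable) P

/-- Continuity in probability: `X_s → X_t` in probability as `s → t`, for every `t ≥ 0`. -/
def ContinuousInProbability (P : Measure Ω) (X : ℝ≥0 → Ω → E) : Prop :=
  ∀ t : ℝ≥0, TendstoInMeasure P X (𝓝 t) (X t)

/-- Solutions to the `(A, lam)` martingale problem that are continuous in probability. -/
def IsContSolution (A : MPOperator E) (Φ : E → ℝ≥0) (lam : Measure E) (P : Measure Ω)
    (X : ℝ≥0 → Ω → E) : Prop :=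
  IsSolution A Φ lam P X ∧ ContinuousInProbability P X

/-- Families `(μ^m(t_1, …, t_m))` of measures on the powers of `E`. -/
abbrev FDDFamily (E : Type u) [MeasurableSpace E] : Type u :=
  (m : ℕ) → (Fin m → ℝ≥0) → Measure (Fin m → E)

/-- The finite-dimensional distributions of a process: `fdd P X m t` is the law of
`(X_{t_1}, …, X_{t_m})`. -/
noncomputable def fdd (P : Measure Ω) (X : ℝ≥0 → Ω → E) : FDDFamily E :=
  fun _ t => P.map (fun ω i => X (t i) ω)

/-- The Markov property of `X` (with respect to `σ(X_u : u ≤ s)`) with transition operators `T`: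
`E[f(X_{s+t}) | σ(X_u : u ≤ s)] = (T_t f)(X_s)` a.s. for bounded Borel `f`. -/
def IsMarkovWith (P : Measure Ω) (X : ℝ≥0 → Ω → E) (T : ℝ≥0 → (E → ℝ) → E → ℝ) : Prop :=
  ∀ (s t : ℝ≥0) (f : E → ℝ), Measurable f → (∃ C : ℝ, ∀ x, |f x| ≤ C) →
    P[fun ω => f (X (s + t) ω) | ⨆ v ≤ s, MeasurableSpace.comap (X v) inferInstance]
      =ᵐ[P] fun ω => T t f (X s ω)

end Processes

section WellPosedness

variable {E : Type u} [MetricSpace E] [MeasurableSpace E] [BorelSpace E]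

/-- Any two solutions to the `(A, lam)` martingale problem that are continuous in probability,
possibly defined on different probability spaces, have the same finite-dimensional
distributions. -/
def UniqueInLaw (A : MPOperator E) (Φ : E → ℝ≥0) (lam : Measure E) : Prop :=
  ∀ (Ω Ω' : Type u) [MeasurableSpace Ω] [MeasurableSpace Ω']
    (P : Measure Ω) (P' : Measure Ω') [IsProbabilityMeasure P] [IsProbabilityMeasure P']
    (X : ℝ≥0 → Ω → E) (X' : ℝ≥0 → Ω' → E),
    IsContSolution A Φ lam P X → IsContSolution A Φ lam P' X' → fdd P X = fdd P' X'

/-- `μ` is the family of finite-dimensional distributions of some solution to the `(A, lam)`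
martingale problem that is continuous in probability. -/
def IsSolutionLaw (A : MPOperator E) (Φ : E → ℝ≥0) (lam : Measure E) (μ : FDDFamily E) : Prop :=
  ∃ (Ω : Type u) (_ : MeasurableSpace Ω) (P : Measure Ω) (_ : IsProbabilityMeasure P)
    (X : ℝ≥0 → Ω → E), IsContSolution A Φ lam P X ∧ fdd P X = μ

/-- Well-posedness of the `(A, lam)` martingale problem in the class of solutions that are
continuous in probability. -/
def WellPosed (A : MPOperator E) (Φ : E → ℝ≥0) (lam : Measure E) : Prop :=
  (∃ (Ω : Type u) (_ : MeasurableSpace Ω) (P : Measure Ω) (_ : IsProbabilityMeasure P)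
    (X : ℝ≥0 → Ω → E), IsContSolution A Φ lam P X) ∧ UniqueInLaw A Φ lam

/-- The domination condition `|A f| ≤ C_f Φ`. -/
def Dominated (A : MPOperator E) (Φ : E → ℝ≥0) : Prop :=
  ∀ f : A.domain, ∃ C : ℝ, ∀ x, |A.toFun f x| ≤ C * Φ x

/-- A set of pairs of functions is closed under bounded pointwise convergence of sequences. -/
def BPClosed (S : Set ((E → ℝ) × (E → ℝ))) : Prop :=
  ∀ (v : ℕ → (E → ℝ) × (E → ℝ)) (p : (E → ℝ) × (E → ℝ)),
    (∀ n, v n ∈ S) →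
    (∃ K : ℝ, ∀ n x, |(v n).1 x| ≤ K ∧ |(v n).2 x| ≤ K) →
    (∀ x, Tendsto (fun n => (v n).1 x) atTop (𝓝 (p.1 x)) ∧
      Tendsto (fun n => (v n).2 x) atTop (𝓝 (p.2 x))) →
    p ∈ S

/-- The bp-closure: the smallest set containing `C` that is closed under bounded pointwise
convergence. If `C` consists of pairs of bounded Borel functions, so does its bp-closure. -/
def bpClosure (C : Set ((E → ℝ) × (E → ℝ))) : Set ((E → ℝ) × (E → ℝ)) :=
  ⋂₀ {S | C ⊆ S ∧ BPClosed S}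

/-- The pair `(f, Φ⁻¹ A f)`. Where `Φ = 0`, also `A f = 0` under the domination condition, and the
quotient is `0`. -/
noncomputable def graphPair (A : MPOperator E) (Φ : E → ℝ≥0) (f : A.domain) :
    (E → ℝ) × (E → ℝ) :=
  (fun x => (f : E →ᵇ ℝ) x, fun x => A.toFun f x / (Φ x : ℝ))

/-- There is a countable `S ⊆ 𝒟(A)` such that the bp-closure of `{(f, Φ⁻¹ A f) : f ∈ S}` contains
`{(f, Φ⁻¹ A f) : f ∈ 𝒟(A)}`. -/
def CountablyBPGenerated (A : MPOperator E) (Φ : E → ℝ≥0) : Prop :=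
  ∃ S : Set A.domain, S.Countable ∧
    Set.range (graphPair A Φ) ⊆ bpClosure (graphPair A Φ '' S)

/-- Well-posedness, in the class of solutions that are continuous in probability, for every
degenerate initial law. -/
def DegenerateWellPosed (A : MPOperator E) (Φ : E → ℝ≥0) : Prop :=
  ∀ x : E, WellPosed A Φ (Measure.dirac x)

/-- Uniqueness in law (among solutions continuous in probability) for all initial laws that
integrate a suitable sequence of `[0, ∞)`-valued Borel functions. -/
def UniqueUnderIntegrability (A : MPOperator E) (Φ : E → ℝ≥0) : Prop :=
  ∃ h : ℕ → E → ℝ≥0, (∀ n, Measurable (h n)) ∧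
    ∀ (lam : Measure E) [IsProbabilityMeasure lam],
      (∀ n, ∫⁻ x, (h n x : ℝ≥0∞) ∂lam < ∞) → UniqueInLaw A Φ lam

theorem DegenerateWellPosed.exists_law {A : MPOperator E} {Φ : E → ℝ≥0}
    (h : DegenerateWellPosed A Φ) (x : E) : ∃ μ, IsSolutionLaw A Φ (Measure.dirac x) μ := by
  obtain ⟨⟨Ω, i, P, hP, X, hX⟩, -⟩ := h x
  exact ⟨_, Ω, i, P, hP, X, hX, rfl⟩

/-- `μ_x`: the finite-dimensional distributions of the (unique in law) solution to the
`(A, δ_x)` martingale problem that is continuous in probability. -/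
noncomputable def degLaw {A : MPOperator E} {Φ : E → ℝ≥0}
    (h : DegenerateWellPosed A Φ) (x : E) : FDDFamily E :=
  Classical.choose (h.exists_law x)

/-- `degLaw` is characterized by its defining property. -/
theorem degLaw_eq_iff {A : MPOperator E} {Φ : E → ℝ≥0} (h : DegenerateWellPosed A Φ) (x : E)
    (μ : FDDFamily E) : IsSolutionLaw A Φ (Measure.dirac x) μ ↔ μ = degLaw h x := by
  have hs : IsSolutionLaw A Φ (Measure.dirac x) (degLaw h x) :=
    Classical.choose_spec (h.exists_law x)
  constructor
  · rintro ⟨Ω, i, P, hP, X, hX, rfl⟩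
    obtain ⟨Ω', i', P', hP', X', hX', he⟩ := hs
    rw [← he]
    exact (h x).2 Ω Ω' P P' X X' hX hX'
  · rintro rfl
    exact hs

/-- `Φ*_N(x) = ∫_0^N ⟨μ_x^1(s), Φ⟩ ds`. -/
noncomputable def phiStar {A : MPOperator E} {Φ : E → ℝ≥0}
    (h : DegenerateWellPosed A Φ) (N : ℕ) (x : E) : ℝ≥0∞ :=
  ∫⁻ s in Set.Ioc (0 : ℝ) (N : ℝ), (∫⁻ y, (Φ (y 0) : ℝ≥0∞) ∂(degLaw h x 1 fun _ => s.toNNReal))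

/-- `𝒫_Φ`: the probability measures `lam` on `E` with `⟨Φ*_N, lam⟩ < ∞` for all `N ≥ 1`. -/
def PPhi {A : MPOperator E} {Φ : E → ℝ≥0} (h : DegenerateWellPosed A Φ) : Set (Measure E) :=
  {lam | IsProbabilityMeasure lam ∧ ∀ N : ℕ, 1 ≤ N → ∫⁻ x, phiStar h N x ∂lam < ∞}

/-- The mixture `ν^m(t_1, …, t_m) = ∫ μ_x^m(t_1, …, t_m) lam(dx)`. -/
noncomputable def mixture {A : MPOperator E} {Φ : E → ℝ≥0} (h : DegenerateWellPosed A Φ)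
    (lam : Measure E) : FDDFamily E :=
  fun m t => lam.bind fun x => degLaw h x m t

/-- `T_t f(x) = ∫ f dμ_x^1(t)`. -/
noncomputable def semigroupOp {A : MPOperator E} {Φ : E → ℝ≥0} (h : DegenerateWellPosed A Φ)
    (t : ℝ≥0) (f : E → ℝ) (x : E) : ℝ :=
  ∫ y, f (y 0) ∂(degLaw h x 1 fun _ => t)

/-- `(T_t)` is a semigroup on the bounded Borel measurable functions. -/
def IsSemigroupOnBoundedBorel (T : ℝ≥0 → (E → ℝ) → E → ℝ) : Prop :=
  ∀ f : E → ℝ, Measurable f → (∃ C : ℝ, ∀ x, |f x| ≤ C) →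
    (∀ t, Measurable (T t f) ∧ ∃ C : ℝ, ∀ x, |T t f x| ≤ C) ∧
    T 0 f = f ∧
    ∀ s t, T (s + t) f = T s (T t f)

end WellPosedness

end MartingaleProblem

open MartingaleProblem

/-! The theorem rests on two points: the laws of solutions form a Borel set in a standard Borel
space of path laws, and conditioning a solution on an event of the past and restarting it gives a
solution again.

Measurability. A process continuous in probability is recovered, up to modification, from its
restriction to rational times, so a solution can be encoded by its law `Q` on `ℚ≥0 → E`. Uniform
continuity in probability on bounded time intervals yields grids depending measurably on `Q`, along
which paths converge almost surely; the limit `canonProcess Q` is measurable jointly in law, time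
and path. By (A2), being the law of a solution amounts to countably many Borel conditions
(`IsSolutionPathLaw`): a countable set of `f`, rational times, and a countable π-system of past
events suffice. By (A3) exactly one such law starts at each `x`, so `x ↦ pathLaw h x` has a Borel
graph and is Borel by Suslin's theorem (`measurable_pathLaw`).

Mixtures. With this kernel, the process on `E × (ℚ≥0 → E)` that runs the canonical solution on each
fibre has the mixtures as finite-dimensional distributions. It solves the problem for `lam` once the
functions `phiStar h N` are `lam`-integrable (`isContSolution_fibreProcess`).

Uniqueness. Let `X` be any solution with initial law `lam`. All `h_n` of (A6) and all `phiStar h N`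
are finite everywhere, so each is bounded on a set `B` of nearly full `lam`-measure. Conditioned on
`X 0 ∈ B`, `X` is a solution to which (A6) applies, and the fibre process over `lam[|B]` is another;
hence their distributions agree, and `B` can be let grow (`IsContSolution.fdd_eq_mixture`). No
integrability of `lam` is assumed; it follows by comparing the expected integrals of `Φ`, which
gives (i).

Markov property. Conditioned on an event `F` of the past of `s` and shifted by `s`, `X` is a
solution, hence a mixture over the law of `X s` given `F`. This is the set-integral form of the
Markov property; starting from `x` and taking `F` to be the whole space gives the semigroup law. -/

namespace MartingaleProblem

/-! ### Borel graphs and a parametrization of probability measures -/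

section Generic

/-- A function whose graph lifts to a Borel relation over a standard Borel space of parameters is
measurable. -/
theorem measurable_of_measurableSet_relation {α Z β : Type*} [MeasurableSpace α]
    [StandardBorelSpace α] [MeasurableSpace Z] [StandardBorelSpace Z] [MeasurableSpace β]
    {R : Set (α × Z)} (hR : MeasurableSet R) {G : Z → β} (hG : Measurable G) {F : α → β}
    (hex : ∀ x, ∃ z, (x, z) ∈ R) (hF : ∀ x z, (x, z) ∈ R → G z = F x) : Measurable F := by
  let := upgradeStandardBorel α
  have key : ∀ B : Set β, MeasurableSet B → AnalyticSet (F ⁻¹' B) := by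
    intro B hB
    have hs : F ⁻¹' B = Prod.fst '' (R ∩ (fun p : α × Z => G p.2) ⁻¹' B) := by
      ext x
      constructor
      · intro hx
        obtain ⟨z, hz⟩ := hex x
        refine ⟨(x, z), ⟨hz, ?_⟩, rfl⟩
        change G z ∈ B
        rw [hF x z hz]
        exact hx
      · rintro ⟨⟨y, z⟩, ⟨hz, hB'⟩, rfl⟩
        change F y ∈ B
        rw [← hF y z hz]
        exact hB'
    rw [hs]
    exact (hR.inter ((hG.comp measurable_snd) hB)).analyticSet_image measurable_fst
  intro B hB
  -- The preimages of `B` and of its complement are both projections of Borel sets, hence analytic,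
  -- so Suslin's theorem applies.
  refine (key B hB).measurableSet_of_compl ?_
  rw [← Set.preimage_compl]
  exact key _ hB.compl

/-- At such points `toRatCDF` changes nothing, so a measure on the line is recovered from the
rational values of its distribution function. -/
theorem isRatStieltjesPoint_cdf (ν : Measure ℝ) :
    IsRatStieltjesPoint (fun w : ℚ → ℝ => w) (fun q : ℚ => cdf ν q) where
  mono := fun a b hab => monotone_cdf ν (by exact_mod_cast hab)
  tendsto_atTop_one := (tendsto_cdf_atTop ν).comp (tendsto_ratCast_atTop_iff.2 tendsto_id)
  tendsto_atBot_zero := (tendsto_cdf_atBot ν).comp (tendsto_ratCast_atBot_iff.2 tendsto_id)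
  iInf_rat_gt_eq := fun t => by
    refine Eq.trans ?_ ((cdf ν).iInf_rat_gt_eq t)
    exact (Equiv.subtypeEquivRight fun r : ℚ => by simp).iInf_congr fun _ => rfl

/-- The probability measures on a standard Borel space are parametrized by a standard Borel
space. -/
theorem exists_surjective_markovKernel (Ω : Type*) [MeasurableSpace Ω] [StandardBorelSpace Ω]
    [Nonempty Ω] : ∃ κ : Kernel (ℚ → ℝ) Ω, IsMarkovKernel κ ∧
      ∀ Q : Measure Ω, IsProbabilityMeasure Q → ∃ w, κ w = Q := by
  have hid : Measurable (fun w : ℚ → ℝ => w) := measurable_id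
  let η : Kernel (ℚ → ℝ) ℝ := ⟨_, measurable_measure_stieltjesOfMeasurableRat hid⟩
  have hη : IsMarkovKernel η := ⟨fun w => instIsProbabilityMeasure_stieltjesOfMeasurableRat hid w⟩
  have he := measurableEmbedding_embeddingReal Ω
  -- `r` is a measurable left inverse of the embedding of `Ω` into the line; it carries measures on
  -- the line back to `Ω`.
  obtain ⟨r, hr, hre⟩ := he.exists_measurable_extend (measurable_id (α := Ω)) fun _ => ‹_›
  refine ⟨η.map r, Kernel.IsMarkovKernel.map _ hr, fun Q hQ => ?_⟩
  have : IsProbabilityMeasure (Q.map (embeddingReal Ω)) :=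
    Measure.isProbabilityMeasure_map he.measurable.aemeasurable
  refine ⟨fun q => cdf (Q.map (embeddingReal Ω)) q, ?_⟩
  have h : η (fun q => cdf (Q.map (embeddingReal Ω)) q) = Q.map (embeddingReal Ω) := by
    refine ext_of_generate_finite _ (BorelSpace.measurable_eq.trans
      Real.borel_eq_generateFrom_Iic_rat) Real.isPiSystem_Iic_rat ?_ (by simp)
    intro s hs
    simp only [Set.mem_iUnion, Set.mem_singleton_iff] at hs
    obtain ⟨q, rfl⟩ := hs
    change (stieltjesOfMeasurableRat _ hid _).measure _ = _
    rw [measure_stieltjesOfMeasurableRat_Iic, stieltjesOfMeasurableRat_eq,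
      toRatCDF_of_isRatStieltjesPoint (isRatStieltjesPoint_cdf _), ofReal_cdf]
  rw [Kernel.map_apply _ hr, h, Measure.map_map hr he.measurable, hre, Measure.map_id]

end Generic

/-! ### Convergence in probability as convergence of a distance -/

section ProbDist

variable {E : Type*} [MetricSpace E] {Ω : Type*} [MeasurableSpace Ω]

/-- The distance of convergence in probability. -/
noncomputable def probDist (P : Measure Ω) (X Y : Ω → E) : ℝ≥0∞ :=
  ∫⁻ ω, min (edist (X ω) (Y ω)) 1 ∂P

theorem probDist_le_one (P : Measure Ω) [IsProbabilityMeasure P] (X Y : Ω → E) :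
    probDist P X Y ≤ 1 := by
  refine (lintegral_mono fun ω => min_le_right _ _).trans ?_
  simp

theorem probDist_comm (P : Measure Ω) (X Y : Ω → E) : probDist P X Y = probDist P Y X := by
  simp [probDist, edist_comm]

variable [MeasurableSpace E] [BorelSpace E] [SecondCountableTopology E]

theorem measurable_min_edist {X Y : Ω → E} (hX : Measurable X) (hY : Measurable Y) :
    Measurable fun ω => min (edist (X ω) (Y ω)) 1 :=
  (hX.edist hY).min measurable_const

theorem probDist_triangle (P : Measure Ω) {X Y Z : Ω → E} (hX : Measurable X) (hY : Measurable Y) :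
    probDist P X Z ≤ probDist P X Y + probDist P Y Z := by
  unfold probDist
  rw [← lintegral_add_left (measurable_min_edist hX hY)]
  refine lintegral_mono fun ω => ?_
  have h := edist_triangle (X ω) (Y ω) (Z ω)
  rcases le_total 1 (edist (X ω) (Y ω)) with h1 | h1
  · exact (min_le_right _ _).trans (by simp [h1])
  rcases le_total 1 (edist (Y ω) (Z ω)) with h2 | h2
  · exact (min_le_right _ _).trans (by simp [h2])
  · rw [min_eq_left h1, min_eq_left h2]
    exact (min_le_left _ _).trans h

theorem tendstoInMeasure_iff_probDist (P : Measure Ω) [IsProbabilityMeasure P] {ι : Type*}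
    {l : Filter ι} {X : ι → Ω → E} {Y : Ω → E} (hX : ∀ i, Measurable (X i)) (hY : Measurable Y) :
    TendstoInMeasure P X l Y ↔ Tendsto (fun i => probDist P (X i) Y) l (𝓝 0) := by
  constructor
  · intro h
    rw [ENNReal.tendsto_nhds_zero]
    intro ε hε
    obtain ⟨δ, hδ, hδε⟩ : ∃ δ : ℝ≥0∞, 0 < δ ∧ δ + δ ≤ ε :=
      ⟨ε / 2, ENNReal.half_pos hε.ne', (ENNReal.add_halves ε).le⟩
    filter_upwards [(ENNReal.tendsto_nhds_zero.1 (h δ hδ)) δ hδ] with i hi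
    refine le_trans ?_ hδε
    have hm : MeasurableSet {ω | δ ≤ edist (X i ω) (Y ω)} :=
      measurableSet_le measurable_const ((hX i).edist hY)
    calc probDist P (X i) Y
        ≤ ∫⁻ ω, (δ + {ω | δ ≤ edist (X i ω) (Y ω)}.indicator 1 ω) ∂P := by
          refine lintegral_mono fun ω => ?_
          by_cases hω : δ ≤ edist (X i ω) (Y ω)
          · rw [Set.indicator_of_mem (by exact hω)]
            exact (min_le_right _ _).trans le_add_self
          · exact (min_le_left _ _).trans ((not_le.1 hω).le.trans le_self_add)
      _ = δ + P {ω | δ ≤ edist (X i ω) (Y ω)} := by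
          rw [lintegral_add_left measurable_const, lintegral_indicator_one hm]
          simp
      _ ≤ δ + δ := by gcongr
  · intro h
    refine fun ε hε => ?_
    have hε' : 0 < min ε 1 := lt_min hε one_pos
    have hb : ∀ i, P {ω | ε ≤ edist (X i ω) (Y ω)} ≤ (min ε 1)⁻¹ * probDist P (X i) Y := by
      intro i
      have h1 := mul_meas_ge_le_lintegral (μ := P) (measurable_min_edist (hX i) hY) (min ε 1)
      have h2 : P {ω | ε ≤ edist (X i ω) (Y ω)} ≤
          P {ω | min ε 1 ≤ min (edist (X i ω) (Y ω)) 1} :=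
        measure_mono fun ω (hω : ε ≤ _) => min_le_min_right 1 hω
      rw [← ENNReal.div_eq_inv_mul, ENNReal.le_div_iff_mul_le (Or.inl hε'.ne')
        (Or.inl (ne_top_of_le_ne_top ENNReal.one_ne_top (min_le_right _ _))), mul_comm]
      exact (mul_le_mul_right h2 _).trans h1
    have h3 : Tendsto (fun i => (min ε 1)⁻¹ * probDist P (X i) Y) l (𝓝 0) := by
      have := ENNReal.Tendsto.const_mul (a := (min ε 1)⁻¹) h
        (Or.inr (ENNReal.inv_ne_top.2 hε'.ne'))
      simpa using this
    exact tendsto_of_tendsto_of_tendsto_of_le_of_le tendsto_const_nhds h3 (fun _ => zero_le) hb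

/-- A sequence with summable consecutive distances in probability converges almost surely. -/
theorem ae_exists_tendsto_of_probDist_le (P : Measure Ω) [CompleteSpace E]
    {X : ℕ → Ω → E} (hX : ∀ n, Measurable (X n)) (N : ℕ)
    (h : ∀ n, N ≤ n → probDist P (X n) (X (n + 1)) ≤ 2⁻¹ ^ n) :
    ∀ᵐ ω ∂P, ∃ x, Tendsto (fun n => X n ω) atTop (𝓝 x) := by
  have hs : ∫⁻ ω, ∑' n, min (edist (X (n + N) ω) (X (n + N + 1) ω)) 1 ∂P ≠ ∞ := by
    rw [lintegral_tsum fun n => (measurable_min_edist (hX _) (hX _)).aemeasurable]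
    refine ne_top_of_le_ne_top (b := ∑' n : ℕ, (2⁻¹ : ℝ≥0∞) ^ n) ?_ (ENNReal.tsum_le_tsum fun n => ?_)
    · rw [ENNReal.tsum_geometric]
      simp
    · exact (h (n + N) (by omega)).trans (pow_le_pow_of_le_one zero_le (by simp) (by omega))
  have hm : Measurable fun ω => ∑' n, min (edist (X (n + N) ω) (X (n + N + 1) ω)) 1 :=
    Measurable.tsum fun n => measurable_min_edist (hX _) (hX _)
  filter_upwards [ae_lt_top hm hs] with ω hω
  have h0 : Tendsto (fun n => min (edist (X (n + N) ω) (X (n + N + 1) ω)) 1) atTop (𝓝 0) :=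
    ENNReal.tendsto_atTop_zero_of_tsum_ne_top hω.ne
  -- From index `M` on the truncation at 1 is inactive, so summability passes to the true distances.
  obtain ⟨M, hM⟩ := eventually_atTop.1 (h0.eventually_lt_const (u := 1) one_pos)
  have hc : CauchySeq fun n => X (n + (M + N)) ω := by
    refine cauchySeq_of_edist_le_of_tsum_ne_top
      (fun n => min (edist (X (n + M + N) ω) (X (n + M + N + 1) ω)) 1) (fun n => ?_) ?_
    · have := hM (n + M) (by omega)
      have h1 : edist (X (n + M + N) ω) (X (n + M + N + 1) ω) ≤ 1 := by
        by_contra hcon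
        rw [min_eq_right (not_le.1 hcon).le] at this
        exact lt_irrefl _ this
      rw [min_eq_left h1]
      have e1 : n + (M + N) = n + M + N := by omega
      have e2 : n.succ + (M + N) = n + M + N + 1 := by omega
      rw [e1, e2]
    · refine ne_top_of_le_ne_top hω.ne ?_
      exact ENNReal.tsum_comp_le_tsum_of_injective (add_left_injective M)
        (fun n => min (edist (X (n + N) ω) (X (n + N + 1) ω)) 1)
  obtain ⟨x, hx⟩ := cauchySeq_tendsto_of_complete hc
  exact ⟨x, (tendsto_add_atTop_iff_nat (M + N)).1 hx⟩

end ProbDist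


/-! ### Reconstruction of a process from its rational times -/

section Grid

/-- The largest multiple of `1 / N` not exceeding `t`. -/
noncomputable def gridPoint (N : ℕ) (t : ℝ≥0) : ℚ≥0 := (⌊N * t⌋₊ : ℚ≥0) / N

theorem gridPoint_le (N : ℕ) (t : ℝ≥0) : (gridPoint N t : ℝ≥0) ≤ t := by
  rcases Nat.eq_zero_or_pos N with rfl | hN
  · simp [gridPoint]
  · have hN' : (0 : ℝ≥0) < N := by exact_mod_cast hN
    simp only [gridPoint, NNRat.cast_div, NNRat.cast_natCast]
    rw [div_le_iff₀ hN', mul_comm t]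
    exact Nat.floor_le zero_le

theorem lt_gridPoint_add {N : ℕ} (hN : 0 < N) (t : ℝ≥0) :
    t < gridPoint N t + 1 / (N : ℝ≥0) := by
  have hN' : (0 : ℝ≥0) < N := by exact_mod_cast hN
  simp only [gridPoint, NNRat.cast_div, NNRat.cast_natCast]
  rw [← add_div, lt_div_iff₀ hN', mul_comm t]
  exact Nat.lt_floor_add_one _

theorem gridPoint_mono (N : ℕ) {s t : ℝ≥0} (h : s ≤ t) : gridPoint N s ≤ gridPoint N t := by
  unfold gridPoint
  gcongr

end Grid

section RationalPaths

variable {E : Type u}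

/-- The path `ω` stopped being observed after time `u`. -/
noncomputable def truncPath (t : ℝ≥0) (ω : ℚ≥0 → E) : ℚ≥0 → E :=
  fun q => if (q : ℝ≥0) ≤ t then ω q else ω 0

theorem truncPath_truncPath {s t : ℝ≥0} (h : s ≤ t) (ω : ℚ≥0 → E) :
    truncPath s (truncPath t ω) = truncPath s ω := by
  funext q
  by_cases hq : (q : ℝ≥0) ≤ s
  · simp [truncPath, hq, hq.trans h]
  · simp [truncPath, hq]

variable [MeasurableSpace E] {Ω : Type u} [MeasurableSpace Ω]

theorem MeasurableProcess.measurable {X : ℝ≥0 → Ω → E}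
    (hX : MeasurableProcess X) (t : ℝ≥0) : Measurable (X t) :=
  hX.comp measurable_prodMk_left

/-- The restriction of a path to rational times. -/
def ratPath (X : ℝ≥0 → Ω → E) (ω : Ω) : ℚ≥0 → E := fun q => X q ω

theorem measurable_ratPath {X : ℝ≥0 → Ω → E} (hX : ∀ t, Measurable (X t)) :
    Measurable (ratPath X) :=
  measurable_pi_lambda _ fun q => hX q

theorem measurable_truncPath (t : ℝ≥0) : Measurable (truncPath (E := E) t) := by
  refine measurable_pi_lambda _ fun q => ?_
  unfold truncPath
  split_ifs
  · exact measurable_pi_apply q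
  · exact measurable_pi_apply 0

end RationalPaths

section Canonical

variable {E : Type u} [MetricSpace E] [MeasurableSpace E]

/-- Consecutive rational times up to `n + 1` at distance at most `1 / (k + n + 1)` are `2⁻ⁿ`-close
in probability. -/
def IsModulus (Q : Measure (ℚ≥0 → E)) (n k : ℕ) : Prop :=
  ∀ p q : ℚ≥0, p ≤ q → q ≤ n + 1 → q ≤ p + 1 / ((k + n + 1 : ℕ) : ℚ≥0) →
    probDist Q (fun ω => ω p) (fun ω => ω q) ≤ 2⁻¹ ^ n

/-- A law on the space of paths over rational times is uniformly continuous in probability on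
bounded sets of times. -/
def HasModulus (Q : Measure (ℚ≥0 → E)) : Prop := ∀ n, ∃ k, IsModulus Q n k

/-- The second alternative makes the search for `k` succeed for every measure, so that `mesh Q n` is
a total and measurable function of `Q`. -/
theorem exists_isModulus_or (Q : Measure (ℚ≥0 → E)) (n : ℕ) :
    ∃ k, IsModulus Q n k ∨ ¬ ∃ k, IsModulus Q n k := by
  by_cases h : ∃ k, IsModulus Q n k
  · obtain ⟨k, hk⟩ := h
    exact ⟨k, Or.inl hk⟩
  · exact ⟨0, Or.inr h⟩

open Classical in
/-- The inverse of the mesh of the `n`-th grid of times adapted to `Q`. -/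
noncomputable def mesh (Q : Measure (ℚ≥0 → E)) (n : ℕ) : ℕ :=
  Nat.find (exists_isModulus_or Q n) + n + 1

theorem mesh_pos (Q : Measure (ℚ≥0 → E)) (n : ℕ) : 0 < mesh Q n := Nat.succ_pos _

/-- Forces the grids to become fine even when the modulus does not require it. -/
theorem le_mesh (Q : Measure (ℚ≥0 → E)) (n : ℕ) : n ≤ mesh Q n := by
  unfold mesh
  omega

open Classical in
theorem HasModulus.mesh_spec {Q : Measure (ℚ≥0 → E)} (h : HasModulus Q) {n : ℕ} {p q : ℚ≥0}
    (hpq : p ≤ q) (hq : (q : ℝ≥0) ≤ n + 1) (hpq' : (q : ℝ≥0) ≤ p + 1 / (mesh Q n : ℝ≥0)) :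
    probDist Q (fun ω => ω p) (fun ω => ω q) ≤ 2⁻¹ ^ n := by
  refine (Nat.find_spec (exists_isModulus_or Q n)).resolve_right (fun hn => hn (h n)) p q hpq
    (by exact_mod_cast hq) ?_
  unfold mesh at hpq'
  have : ((q : ℚ≥0) : ℝ≥0) ≤ ((p + 1 / ((Nat.find (exists_isModulus_or Q n) + n + 1 : ℕ) : ℚ≥0) :
      ℚ≥0) : ℝ≥0) := by
    push_cast at hpq' ⊢
    exact hpq'
  exact_mod_cast this

theorem tendsto_gridPoint_mesh (Q : Measure (ℚ≥0 → E)) (t : ℝ≥0) :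
    Tendsto (fun n => (gridPoint (mesh Q n) t : ℝ≥0)) atTop (𝓝 t) := by
  have h1 : Tendsto (fun n => 1 / (mesh Q n : ℝ≥0)) atTop (𝓝 0) :=
    tendsto_one_div_atTop_nhds_zero_nat.comp (tendsto_atTop_mono (le_mesh Q) tendsto_id)
  have h2 : Tendsto (fun n => t - 1 / (mesh Q n : ℝ≥0)) atTop (𝓝 t) := by
    simpa using (tendsto_const_nhds (x := t)).sub h1
  refine tendsto_of_tendsto_of_tendsto_of_le_of_le h2 tendsto_const_nhds (fun n => ?_)
    (fun n => gridPoint_le _ _)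
  exact tsub_le_iff_right.2 (lt_gridPoint_add (mesh_pos Q n) t).le

section Truncation

variable [Nonempty E]

/-- The process on the space of paths over rational times obtained by passing to the limit along
grids adapted to `Q`. -/
noncomputable def canonProcess (Q : Measure (ℚ≥0 → E)) (t : ℝ≥0) (ω : ℚ≥0 → E) : E :=
  limUnder atTop fun n => ω (gridPoint (mesh Q n) t)

/-- Grid points are rounded down, so the value at `s` uses rational times up to `s` only. This is
what keeps the canonical process adapted. -/
theorem canonProcess_truncPath (Q : Measure (ℚ≥0 → E)) {s t : ℝ≥0} (h : s ≤ t) (ω : ℚ≥0 → E) :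
    canonProcess Q s (truncPath t ω) = canonProcess Q s ω := by
  unfold canonProcess
  congr 1
  funext n
  simp [truncPath, (gridPoint_le (mesh Q n) s).trans h]

theorem timeIntegral_canonProcess_truncPath (Q : Measure (ℚ≥0 → E)) (g : E → ℝ) {s t : ℝ≥0}
    (h : s ≤ t) (ω : ℚ≥0 → E) :
    timeIntegral g (canonProcess Q) s (truncPath t ω) = timeIntegral g (canonProcess Q) s ω := by
  refine setIntegral_congr_fun measurableSet_Ioc fun r hr => ?_
  rw [canonProcess_truncPath Q ((Real.toNNReal_le_iff_le_coe.2 hr.2).trans h)]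

end Truncation

variable [BorelSpace E] [SecondCountableTopology E]

theorem measurableSet_isModulus (n k : ℕ) :
    MeasurableSet {Q : Measure (ℚ≥0 → E) | IsModulus Q n k} := by
  have : {Q : Measure (ℚ≥0 → E) | IsModulus Q n k} = ⋂ (p : ℚ≥0) (q : ℚ≥0) (_ : p ≤ q)
      (_ : q ≤ n + 1) (_ : q ≤ p + 1 / ((k + n + 1 : ℕ) : ℚ≥0)),
      {Q | probDist Q (fun ω => ω p) (fun ω => ω q) ≤ 2⁻¹ ^ n} := by
    ext Q
    simp [IsModulus]
  rw [this]
  refine MeasurableSet.iInter fun p => MeasurableSet.iInter fun q => MeasurableSet.iInter fun _ =>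
    MeasurableSet.iInter fun _ => MeasurableSet.iInter fun _ => measurableSet_le ?_ measurable_const
  exact Measure.measurable_lintegral
    (measurable_min_edist (measurable_pi_apply p) (measurable_pi_apply q))

theorem measurableSet_hasModulus : MeasurableSet {Q : Measure (ℚ≥0 → E) | HasModulus Q} := by
  have : {Q : Measure (ℚ≥0 → E) | HasModulus Q} = ⋂ n, ⋃ k, {Q | IsModulus Q n k} := by
    ext Q
    simp [HasModulus]
  rw [this]
  exact MeasurableSet.iInter fun n => MeasurableSet.iUnion fun k => measurableSet_isModulus n k

open Classical in
theorem measurable_mesh (n : ℕ) : Measurable fun Q : Measure (ℚ≥0 → E) => mesh Q n := by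
  have h : Measurable fun Q : Measure (ℚ≥0 → E) => Nat.find (exists_isModulus_or Q n) := by
    refine measurable_find _ fun k => ?_
    have : {Q : Measure (ℚ≥0 → E) | IsModulus Q n k ∨ ¬ ∃ k, IsModulus Q n k} =
        {Q | IsModulus Q n k} ∪ (⋃ k, {Q | IsModulus Q n k})ᶜ := by
      ext Q
      simp
    rw [this]
    exact (measurableSet_isModulus n k).union
      (MeasurableSet.iUnion fun k => measurableSet_isModulus n k).compl
  exact (measurable_of_countable fun k : ℕ => k + n + 1).comp h


variable {Ω : Type u} [MeasurableSpace Ω]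

/-- By the triangle inequality the distance in probability of `X s` and `X t` is continuous in `(s,
t)`, hence uniformly continuous on a compact square; the pair `(p, q)` is compared with the diagonal
point `(p, p)`, where the distance vanishes. -/
theorem HasModulus.of_continuousInProbability {P : Measure Ω} [IsProbabilityMeasure P]
    {X : ℝ≥0 → Ω → E} (hX : ∀ t, Measurable (X t)) (hc : ContinuousInProbability P X) :
    HasModulus (P.map (ratPath X)) := by
  intro n
  have hc' : ∀ t, Tendsto (fun s => probDist P (X s) (X t)) (𝓝 t) (𝓝 0) := fun t =>
    (tendstoInMeasure_iff_probDist P hX (hX t)).1 (hc t)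
  have hcont : Continuous fun p : ℝ≥0 × ℝ≥0 => (probDist P (X p.1) (X p.2)).toReal := by
    have hfin : ∀ s t, probDist P (X s) (X t) ≠ ∞ := fun s t =>
      ne_top_of_le_ne_top ENNReal.one_ne_top (probDist_le_one P _ _)
    rw [continuous_iff_continuousAt]
    rintro ⟨s, t⟩
    have h0 : Tendsto (fun p : ℝ≥0 × ℝ≥0 =>
        (probDist P (X p.1) (X s)).toReal + (probDist P (X p.2) (X t)).toReal)
        (𝓝 (s, t)) (𝓝 0) := by
      have h1 := (ENNReal.tendsto_toReal ENNReal.zero_ne_top).comp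
        ((hc' s).comp (continuous_fst.tendsto (s, t)))
      have h2 := (ENNReal.tendsto_toReal ENNReal.zero_ne_top).comp
        ((hc' t).comp (continuous_snd.tendsto (s, t)))
      simpa using h1.add h2
    refine tendsto_iff_dist_tendsto_zero.2 (squeeze_zero (fun _ => dist_nonneg) (fun p => ?_) h0)
    have tri : ∀ a b c d, (probDist P (X a) (X b)).toReal ≤ (probDist P (X a) (X c)).toReal +
        (probDist P (X c) (X d)).toReal + (probDist P (X b) (X d)).toReal := by
      intro a b c d
      rw [← ENNReal.toReal_add (hfin _ _) (hfin _ _), ← ENNReal.toReal_add (by simp [hfin]) (hfin _ _)]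
      refine ENNReal.toReal_mono (by simp [hfin]) ?_
      refine (probDist_triangle P (hX a) (hX c)).trans ?_
      rw [add_assoc, probDist_comm P (X b)]
      gcongr
      exact probDist_triangle P (hX c) (hX d)
    have h1 := tri p.1 p.2 s t
    have h2 := tri s t p.1 p.2
    rw [probDist_comm P (X s) (X p.1), probDist_comm P (X t) (X p.2)] at h2
    rw [Real.dist_eq, abs_le]
    dsimp only
    constructor <;> linarith
  have hu := (isCompact_Icc (a := (0 : ℝ≥0)) (b := n + 1)).prod
    (isCompact_Icc (a := (0 : ℝ≥0)) (b := n + 1)) |>.uniformContinuousOn_of_continuous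
    hcont.continuousOn
  rw [Metric.uniformContinuousOn_iff] at hu
  obtain ⟨δ, hδ, h⟩ := hu (2⁻¹ ^ n) (by positivity)
  obtain ⟨k, hk⟩ := exists_nat_one_div_lt hδ
  refine ⟨k, fun p q hpq hq hpq' => ?_⟩
  have hpq0 : (p : ℝ≥0) ≤ q := by exact_mod_cast hpq
  have hq0 : (q : ℝ≥0) ≤ n + 1 := by exact_mod_cast hq
  have hd : dist ((p : ℝ≥0), (q : ℝ≥0)) ((p : ℝ≥0), (p : ℝ≥0)) < δ := by
    rw [Prod.dist_eq, dist_self, max_eq_right dist_nonneg, NNReal.dist_eq]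
    have h1 : (((q : ℝ≥0)) : ℝ) ≤ ((p : ℝ≥0) : ℝ) + 1 / ((k + n + 1 : ℕ) : ℝ) := by
      have : (q : ℝ≥0) ≤ ((p + 1 / ((k + n + 1 : ℕ) : ℚ≥0) : ℚ≥0) : ℝ≥0) := by
        exact_mod_cast hpq'
      have h := NNReal.coe_le_coe.2 this
      push_cast at h ⊢
      exact h
    have h2 : 1 / ((k + n + 1 : ℕ) : ℝ) ≤ 1 / ((k : ℝ) + 1) := by
      apply one_div_le_one_div_of_le (by positivity)
      push_cast
      linarith [(Nat.cast_nonneg n : (0 : ℝ) ≤ n)]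
    have h3 : ((p : ℝ≥0) : ℝ) ≤ ((q : ℝ≥0) : ℝ) := by exact_mod_cast hpq0
    rw [abs_of_nonneg (by linarith)]
    linarith
  have h4 := h _ ⟨⟨zero_le, hpq0.trans hq0⟩, ⟨zero_le, hq0⟩⟩ _
    ⟨⟨zero_le, hpq0.trans hq0⟩, ⟨zero_le, hpq0.trans hq0⟩⟩ hd
  have h5 : probDist P (X p) (X p) = 0 := by simp [probDist]
  have hmap : probDist (P.map (ratPath X)) (fun ω => ω p) (fun ω => ω q) =
      probDist P (X p) (X q) := by
    unfold probDist
    rw [lintegral_map (measurable_min_edist (measurable_pi_apply p) (measurable_pi_apply q))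
      (measurable_ratPath hX)]
    rfl
  rw [hmap]
  simp only [h5, ENNReal.toReal_zero, Real.dist_eq, sub_zero, abs_of_nonneg ENNReal.toReal_nonneg]
    at h4
  rw [← ENNReal.ofReal_toReal (ne_top_of_le_ne_top ENNReal.one_ne_top (probDist_le_one P _ _))]
  refine (ENNReal.ofReal_le_ofReal h4.le).trans ?_
  rw [ENNReal.ofReal_pow (by positivity), ENNReal.ofReal_inv_of_pos (by positivity)]
  simp

variable [Nonempty E] [CompleteSpace E]

/-- Measurability in the law `Q` itself, and not only in time and path, is what later makes
conditions on `Q` Borel. -/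
theorem measurable_canonProcess :
    Measurable fun p : Measure (ℚ≥0 → E) × ℝ≥0 × (ℚ≥0 → E) => canonProcess p.1 p.2.1 p.2.2 := by
  refine (StronglyMeasurable.limUnder (l := atTop)
    (f := fun n (p : Measure (ℚ≥0 → E) × ℝ≥0 × (ℚ≥0 → E)) =>
      p.2.2 (gridPoint (mesh p.1 n) p.2.1)) fun n => ?_).measurable
  refine Measurable.stronglyMeasurable ?_
  have he : Measurable fun p : (ℕ × ℕ) × (ℚ≥0 → E) => p.2 ((p.1.2 : ℚ≥0) / p.1.1) :=
    measurable_from_prod_countable_right fun i =>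
      measurable_pi_apply (X := fun _ : ℚ≥0 => E) ((i.2 : ℚ≥0) / i.1)
  have hN : Measurable fun p : Measure (ℚ≥0 → E) × ℝ≥0 × (ℚ≥0 → E) => mesh p.1 n :=
    (measurable_mesh n).comp measurable_fst
  have hk : Measurable fun p : Measure (ℚ≥0 → E) × ℝ≥0 × (ℚ≥0 → E) => ⌊mesh p.1 n * p.2.1⌋₊ :=
    Nat.measurable_floor.comp
      (((measurable_of_countable fun k : ℕ => (k : ℝ≥0)).comp hN).mul measurable_snd.fst)
  exact he.comp ((hN.prodMk hk).prodMk measurable_snd.snd)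

theorem measurableProcess_canonProcess (Q : Measure (ℚ≥0 → E)) :
    MeasurableProcess (canonProcess Q) :=
  measurable_canonProcess.comp (measurable_const.prodMk measurable_id)

theorem HasModulus.ae_tendsto {Q : Measure (ℚ≥0 → E)} (hQ : HasModulus Q) (t : ℝ≥0) :
    ∀ᵐ ω ∂Q, Tendsto (fun n => ω (gridPoint (mesh Q n) t)) atTop (𝓝 (canonProcess Q t ω)) := by
  have h := ae_exists_tendsto_of_probDist_le Q
    (X := fun n (ω : ℚ≥0 → E) => ω (gridPoint (mesh Q n) t)) (fun n => measurable_pi_apply _)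
    ⌈t⌉₊ fun n hn => ?_
  · filter_upwards [h] with ω hω using tendsto_nhds_limUnder hω
  · have ht : t ≤ n := (Nat.le_ceil t).trans (by exact_mod_cast hn)
    have ht' : t ≤ n + 1 := ht.trans (by simp)
    -- The grids need not be nested, so either point may come first. Both lie below `t`, and `t` is
    -- within one mesh of the earlier one, whose level provides the modulus.
    rcases le_total (gridPoint (mesh Q n) t) (gridPoint (mesh Q (n + 1)) t) with h1 | h1
    · exact hQ.mesh_spec h1 ((gridPoint_le _ _).trans ht')
        ((gridPoint_le _ _).trans (lt_gridPoint_add (mesh_pos Q n) t).le)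
    · rw [probDist_comm]
      refine (hQ.mesh_spec (n := n + 1) h1 ((gridPoint_le _ _).trans (ht'.trans (by simp)))
        ((gridPoint_le _ _).trans (lt_gridPoint_add (mesh_pos Q _) t).le)).trans ?_
      exact pow_le_pow_of_le_one zero_le (by simp) (Nat.le_succ n)

/-- Fatou's lemma along the grids. The strict bound on `t` leaves room for the grid points of `s`,
which approach `s` from below. -/
theorem HasModulus.probDist_canonProcess_le {Q : Measure (ℚ≥0 → E)} (hQ : HasModulus Q) {m : ℕ}
    {s t : ℝ≥0} (hst : s ≤ t) (ht : t < m + 1) (hst' : t < s + 1 / (mesh Q m : ℝ≥0)) :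
    probDist Q (canonProcess Q s) (canonProcess Q t) ≤ 2⁻¹ ^ m := by
  have h1 : probDist Q (canonProcess Q s) (canonProcess Q t) ≤
      ∫⁻ ω, liminf (fun n => min (edist (ω (gridPoint (mesh Q n) s))
        (ω (gridPoint (mesh Q n) t))) 1) atTop ∂Q := by
    refine lintegral_mono_ae ?_
    filter_upwards [hQ.ae_tendsto s, hQ.ae_tendsto t] with ω hs ht
    exact ((hs.edist ht).min tendsto_const_nhds).liminf_eq.ge
  have h0 : ∀ n, Measurable fun ω : ℚ≥0 → E => min (edist (ω (gridPoint (mesh Q n) s))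
        (ω (gridPoint (mesh Q n) t))) 1 := fun n =>
    measurable_min_edist (measurable_pi_apply _) (measurable_pi_apply _)
  refine h1.trans ((lintegral_liminf_le h0).trans ?_)
  refine liminf_le_of_frequently_le' (Eventually.frequently ?_)
  have h2 : ∀ᶠ n in atTop, t < (gridPoint (mesh Q n) s : ℝ≥0) + 1 / (mesh Q m : ℝ≥0) :=
    ((tendsto_gridPoint_mesh Q s).add_const _).eventually_const_lt hst'
  filter_upwards [h2] with n hn
  exact hQ.mesh_spec (gridPoint_mono _ hst) ((gridPoint_le _ _).trans ht.le)
    ((gridPoint_le _ _).trans hn.le)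

theorem HasModulus.continuousInProbability {Q : Measure (ℚ≥0 → E)} [IsProbabilityMeasure Q]
    (hQ : HasModulus Q) : ContinuousInProbability Q (canonProcess Q) := by
  intro t
  have hm := (measurableProcess_canonProcess Q).measurable
  rw [tendstoInMeasure_iff_probDist Q hm (hm t), ENNReal.tendsto_nhds_zero]
  intro ε hε
  obtain ⟨m, hm1, hm2⟩ : ∃ m : ℕ, (2⁻¹ : ℝ≥0∞) ^ m ≤ ε ∧ t ≤ m := by
    have h1 : ∀ᶠ m : ℕ in atTop, (2⁻¹ : ℝ≥0∞) ^ m ≤ ε :=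
      (ENNReal.tendsto_pow_atTop_nhds_zero_of_lt_one (by simp)).eventually_le_const hε
    exact (h1.and (eventually_atTop.2 ⟨⌈t⌉₊, fun m hm =>
      (Nat.le_ceil t).trans (by exact_mod_cast hm)⟩)).exists
  have hN : (0 : ℝ≥0) < 1 / (mesh Q m : ℝ≥0) := by
    have : (0 : ℝ≥0) < mesh Q m := by exact_mod_cast mesh_pos Q m
    positivity
  have ht : t < m + 1 := lt_of_le_of_lt hm2 (by simp)
  have e1 : ∀ᶠ s in 𝓝 t, t < s + 1 / (mesh Q m : ℝ≥0) :=
    (tendsto_id.add_const _).eventually_const_lt (u := t) (lt_add_of_pos_right t hN)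
  filter_upwards [e1, eventually_lt_nhds (lt_add_of_pos_right t hN), eventually_lt_nhds ht]
    with s h1 h2 h3
  refine le_trans ?_ hm1
  rcases le_total s t with h | h
  · exact hQ.probDist_canonProcess_le h ht h1
  · rw [probDist_comm]
    exact hQ.probDist_canonProcess_le h h3 h2

/-- The values at the grid points of `q` converge almost surely to `canonProcess Q q` and, by the
modulus, in probability to the value at `q`; limits in probability are unique. -/
theorem HasModulus.canonProcess_rat {Q : Measure (ℚ≥0 → E)} [IsProbabilityMeasure Q]
    (hQ : HasModulus Q) (q : ℚ≥0) : ∀ᵐ ω ∂Q, canonProcess Q q ω = ω q := by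
  have hm := (measurableProcess_canonProcess Q).measurable
  have h1 : TendstoInMeasure Q (fun n (ω : ℚ≥0 → E) => ω (gridPoint (mesh Q n) q)) atTop
      (canonProcess Q q) :=
    tendstoInMeasure_of_tendsto_ae (fun n => (measurable_pi_apply _).aestronglyMeasurable)
      (hQ.ae_tendsto q)
  have h2 : TendstoInMeasure Q (fun n (ω : ℚ≥0 → E) => ω (gridPoint (mesh Q n) q)) atTop
      (fun ω => ω q) := by
    rw [tendstoInMeasure_iff_probDist (X := fun n (ω : ℚ≥0 → E) => ω (gridPoint (mesh Q n) q))
      (Y := fun ω => ω q) Q (fun n => measurable_pi_apply _) (measurable_pi_apply _)]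
    refine tendsto_of_tendsto_of_tendsto_of_le_of_le' tendsto_const_nhds
      (ENNReal.tendsto_pow_atTop_nhds_zero_of_lt_one (r := 2⁻¹) (by simp))
      (Eventually.of_forall fun _ => zero_le) ?_
    filter_upwards [eventually_ge_atTop ⌈(q : ℝ≥0)⌉₊] with n hn
    have hq : (q : ℝ≥0) ≤ n := (Nat.le_ceil (q : ℝ≥0)).trans (by exact_mod_cast hn)
    exact hQ.mesh_spec (by exact_mod_cast gridPoint_le (mesh Q n) (q : ℝ≥0))
      (hq.trans (by simp)) (lt_gridPoint_add (mesh_pos Q n) _).le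
  exact tendstoInMeasure_ae_unique h1 h2

/-- A process that is continuous in probability is a modification of the canonical process of its
law, evaluated along its paths. -/
theorem canonProcess_ratPath {P : Measure Ω} [IsProbabilityMeasure P]
    {X : ℝ≥0 → Ω → E} (hX : ∀ t, Measurable (X t)) (hc : ContinuousInProbability P X) (t : ℝ≥0) :
    (fun ω => canonProcess (P.map (ratPath X)) t (ratPath X ω)) =ᵐ[P] X t := by
  have hQ := HasModulus.of_continuousInProbability hX hc
  have h1 := ae_of_ae_map (measurable_ratPath hX).aemeasurable (hQ.ae_tendsto t)
  have h2 : TendstoInMeasure P (fun n ω => X (gridPoint (mesh (P.map (ratPath X)) n) t) ω) atTop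
      (fun ω => canonProcess (P.map (ratPath X)) t (ratPath X ω)) :=
    tendstoInMeasure_of_tendsto_ae (fun n => (hX _).aestronglyMeasurable) h1
  exact tendstoInMeasure_ae_unique h2 fun ε hε =>
    (hc t ε hε).comp (tendsto_gridPoint_mesh (P.map (ratPath X)) t)

end Canonical


/-! ### Time integrals under the bound by `Φ`, and invariance under modification -/

section Integrals

variable {E : Type u} {Ω : Type u} [MeasurableSpace Ω]

/-- The expected time integral of `Φ` along `X` is finite over bounded time intervals. -/
def ExpectedIntegralFinite (Φ : E → ℝ≥0) (P : Measure Ω) (X : ℝ≥0 → Ω → E) : Prop :=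
  ∀ T : ℝ≥0,
    ∫⁻ ω, (∫⁻ s in Set.Ioc (0 : ℝ) (T : ℝ), (Φ (X s.toNNReal ω) : ℝ≥0∞)) ∂P < ∞

variable {Φ : E → ℝ≥0} {P : Measure Ω} {X : ℝ≥0 → Ω → E}

theorem ExpectedIntegralFinite.mono_measure (hI : ExpectedIntegralFinite Φ P X) {P' : Measure Ω}
    (h : P' ≤ P) : ExpectedIntegralFinite Φ P' X := fun T =>
  (lintegral_mono' h le_rfl).trans_lt (hI T)

variable [MeasurableSpace E]

theorem MeasurableProcess.measurable_uncurry_real (hX : MeasurableProcess X) :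
    Measurable fun p : Ω × ℝ => X p.2.toNNReal p.1 :=
  hX.comp ((measurable_real_toNNReal.comp measurable_snd).prodMk measurable_fst)

theorem timeIntegral_eq_integral_map (hX : MeasurableProcess X) {g : E → ℝ} (hg : Measurable g)
    (t : ℝ≥0) (ω : Ω) : timeIntegral g X t ω =
      ∫ x, g x ∂((volume.restrict (Set.Ioc (0 : ℝ) t)).map fun s => X s.toNNReal ω) := by
  have h : Measurable fun s : ℝ => X s.toNNReal ω :=
    hX.measurable_uncurry_real.comp measurable_prodMk_left
  rw [integral_map h.aemeasurable hg.aestronglyMeasurable]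
  rfl

theorem ExpectedIntegralFinite.integrable_prod (hΦ : Measurable Φ) (hX : MeasurableProcess X)
    (hI : ExpectedIntegralFinite Φ P X) {g : E → ℝ} (hg : Measurable g) {C : ℝ}
    (hC : ∀ x, |g x| ≤ C * Φ x) (T : ℝ≥0) :
    Integrable (fun p : Ω × ℝ => g (X p.2.toNNReal p.1))
      (P.prod (volume.restrict (Set.Ioc (0 : ℝ) T))) := by
  have hm := hX.measurable_uncurry_real
  have h1 : Integrable (fun p : Ω × ℝ => (Φ (X p.2.toNNReal p.1) : ℝ))
      (P.prod (volume.restrict (Set.Ioc (0 : ℝ) T))) := by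
    refine ⟨((measurable_coe_nnreal_real.comp hΦ).comp hm).aestronglyMeasurable, ?_⟩
    have : Measurable fun p : Ω × ℝ => (Φ (X p.2.toNNReal p.1) : ℝ≥0∞) :=
      (hΦ.comp hm).coe_nnreal_ennreal
    have he : ∀ r : ℝ≥0, ‖(r : ℝ)‖ₑ = r := fun r => by
      rw [Real.enorm_eq_ofReal r.coe_nonneg, ENNReal.ofReal_coe_nnreal]
    simp only [HasFiniteIntegral, he]
    rw [lintegral_prod _ this.aemeasurable]
    exact hI T
  refine (h1.const_mul C).mono' (hg.comp hm).aestronglyMeasurable (Eventually.of_forall fun p => ?_)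
  exact hC _

theorem ExpectedIntegralFinite.integrable_timeIntegral (hΦ : Measurable Φ)
    (hX : MeasurableProcess X) (hI : ExpectedIntegralFinite Φ P X) {g : E → ℝ} (hg : Measurable g)
    {C : ℝ} (hC : ∀ x, |g x| ≤ C * Φ x) (T : ℝ≥0) : Integrable (timeIntegral g X T) P :=
  (hI.integrable_prod hΦ hX hg hC T).integral_prod_left

variable [IsFiniteMeasure P]

theorem ExpectedIntegralFinite.ae_integrableOn (hΦ : Measurable Φ)
    (hX : MeasurableProcess X) (hI : ExpectedIntegralFinite Φ P X) {g : E → ℝ} (hg : Measurable g)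
    {C : ℝ} (hC : ∀ x, |g x| ≤ C * Φ x) (T : ℝ≥0) :
    ∀ᵐ ω ∂P, IntegrableOn (fun s : ℝ => g (X s.toNNReal ω)) (Set.Ioc (0 : ℝ) T) :=
  (hI.integrable_prod hΦ hX hg hC T).prod_right_ae

theorem ExpectedIntegralFinite.integral_timeIntegral (hΦ : Measurable Φ)
    (hX : MeasurableProcess X) (hI : ExpectedIntegralFinite Φ P X) {g : E → ℝ} (hg : Measurable g)
    {C : ℝ} (hC : ∀ x, |g x| ≤ C * Φ x) (T : ℝ≥0) :
    ∫ ω, timeIntegral g X T ω ∂P = ∫ p, g (X p.2.toNNReal p.1)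
      ∂(P.prod (volume.restrict (Set.Ioc (0 : ℝ) T))) :=
  (integral_prod _ (hI.integrable_prod hΦ hX hg hC T)).symm

/-- After Fubini this is a primitive of an integrable function of time. -/
theorem ExpectedIntegralFinite.continuous_integral_timeIntegral (hΦ : Measurable Φ)
    (hX : MeasurableProcess X) (hI : ExpectedIntegralFinite Φ P X) {g : E → ℝ} (hg : Measurable g)
    {C : ℝ} (hC : ∀ x, |g x| ≤ C * Φ x) :
    Continuous fun t => ∫ ω, timeIntegral g X t ω ∂P := by
  have h1 : ∀ T : ℝ≥0, ∫ ω, timeIntegral g X T ω ∂P =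
      ∫ s in Set.Ioc (0 : ℝ) T, ∫ ω, g (X s.toNNReal ω) ∂P := fun T =>
    integral_integral_swap (hI.integrable_prod hΦ hX hg hC T)
  simp only [h1]
  rw [continuous_iff_continuousAt]
  intro t
  have h2 : IntegrableOn (fun s : ℝ => ∫ ω, g (X s.toNNReal ω) ∂P)
      (Set.Icc (0 : ℝ) ((t + 1 : ℝ≥0) : ℝ)) := by
    rw [integrableOn_Icc_iff_integrableOn_Ioc]
    exact (hI.integrable_prod hΦ hX hg hC (t + 1)).integral_prod_right
  have h3 := (intervalIntegral.continuousOn_primitive h2) (t : ℝ) ⟨t.2, by push_cast; linarith⟩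
  have h4 : Tendsto (fun s : ℝ≥0 => (s : ℝ)) (𝓝 t)
      (𝓝[Set.Icc (0 : ℝ) ((t + 1 : ℝ≥0) : ℝ)] (t : ℝ)) := by
    refine tendsto_nhdsWithin_iff.2 ⟨(NNReal.continuous_coe.tendsto t), ?_⟩
    filter_upwards [eventually_lt_nhds (lt_add_of_pos_right t one_pos)] with s hs
    exact ⟨s.2, NNReal.coe_le_coe.2 hs.le⟩
  exact h3.tendsto.comp h4

end Integrals

section Modification

variable {E : Type u} [MetricSpace E] [MeasurableSpace E] [BorelSpace E]
  [SecondCountableTopology E] {Ω : Type u} [MeasurableSpace Ω]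
  {P : Measure Ω} [IsFiniteMeasure P] {X Y : ℝ≥0 → Ω → E}

/-- Fubini: the set of `(ω, s)` where the two processes differ has null sections at every fixed `s`.
-/
theorem ae_ae_eq_of_modification (hX : MeasurableProcess X) (hY : MeasurableProcess Y)
    (h : ∀ t, X t =ᵐ[P] Y t) (T : ℝ≥0) :
    ∀ᵐ ω ∂P, ∀ᵐ s ∂(volume.restrict (Set.Ioc (0 : ℝ) T)), X s.toNNReal ω = Y s.toNNReal ω := by
  have hm : MeasurableSet {p : Ω × ℝ | X p.2.toNNReal p.1 = Y p.2.toNNReal p.1} :=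
    measurableSet_eq_fun hX.measurable_uncurry_real hY.measurable_uncurry_real
  exact (Measure.ae_ae_comm hm).2 (Eventually.of_forall fun s => h _)

theorem timeIntegral_ae_eq_of_modification (hX : MeasurableProcess X) (hY : MeasurableProcess Y)
    (h : ∀ t, X t =ᵐ[P] Y t) (g : E → ℝ) (T : ℝ≥0) :
    timeIntegral g X T =ᵐ[P] timeIntegral g Y T := by
  filter_upwards [ae_ae_eq_of_modification hX hY h T] with ω hω
  refine integral_congr_ae ?_
  filter_upwards [hω] with s hs
  rw [hs]

theorem lintegral_occupation_eq_of_modification (hX : MeasurableProcess X)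
    (hY : MeasurableProcess Y) (h : ∀ t, X t =ᵐ[P] Y t) (Φ : E → ℝ≥0) (T : ℝ≥0) :
    ∫⁻ ω, (∫⁻ s in Set.Ioc (0 : ℝ) (T : ℝ), (Φ (X s.toNNReal ω) : ℝ≥0∞)) ∂P =
      ∫⁻ ω, (∫⁻ s in Set.Ioc (0 : ℝ) (T : ℝ), (Φ (Y s.toNNReal ω) : ℝ≥0∞)) ∂P := by
  refine lintegral_congr_ae ?_
  filter_upwards [ae_ae_eq_of_modification hX hY h T] with ω hω
  refine lintegral_congr_ae ?_
  filter_upwards [hω] with s hs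
  rw [hs]

end Modification

/-! ### Adaptedness of time integrals -/

section Filtration

theorem measurable_integral_measure {α β : Type*} [MeasurableSpace α] [MeasurableSpace β]
    {O : α → Measure β} (hO : Measurable O) {g : β → ℝ} (hg : Measurable g) :
    Measurable fun a => ∫ b, g b ∂(O a) :=
  (StronglyMeasurable.integral_kernel (κ := ⟨O, hO⟩) hg.stronglyMeasurable).measurable

variable {E : Type u} [MetricSpace E] [MeasurableSpace E] [BorelSpace E]
  {Ω : Type u} [mΩ : MeasurableSpace Ω] {X : ℝ≥0 → Ω → E}

theorem measurable_starFiltration (hX : MeasurableProcess X) {u t : ℝ≥0} (h : u ≤ t) :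
    Measurable[starFiltration X hX t] (X u) := by
  rw [measurable_iff_comap_le]
  exact le_sup_of_le_left (le_iSup₂_of_le u h le_rfl)

/-- The time integral of any Borel function is adapted to the augmented filtration, although the
latter only refers to bounded continuous functions. -/
theorem measurable_timeIntegral_starFiltration (hX : MeasurableProcess X) {g : E → ℝ}
    (hg : Measurable g) (t : ℝ≥0) : Measurable[starFiltration X hX t] (timeIntegral g X t) := by
  have hXω : ∀ ω, Measurable fun s : ℝ => X s.toNNReal ω := fun ω =>
    hX.measurable_uncurry_real.comp measurable_prodMk_left
  -- The time integral of `g` is its integral against the occupation measure `O ω`, so measurability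
  -- of `O` as a measure-valued map suffices. This can be tested on closed sets, whose indicators
  -- are limits of bounded continuous functions.
  let O : Ω → Measure E := fun ω =>
    (volume.restrict (Set.Ioc (0 : ℝ) t)).map fun s => X s.toNNReal ω
  have hfin : ∀ ω, IsFiniteMeasure (O ω) := fun ω => Measure.isFiniteMeasure_map _ _
  have hO : Measurable[starFiltration X hX t] O := by
    refine @Measurable.measure_of_isPiSystem Ω E (starFiltration X hX t) _ O hfin
      {s | IsClosed s} ?_ isPiSystem_isClosed ?_ ?_
    · rw [← borel_eq_generateFrom_isClosed, ← BorelSpace.measurable_eq]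
    · intro B hB
      have hB' : IsClosed B := hB
      have h1 : ∀ n, Measurable[starFiltration X hX t]
          fun ω => ∫⁻ x, (hB'.apprSeq n x : ℝ≥0∞) ∂(O ω) := by
        intro n
        have hcont : Continuous fun x => (hB'.apprSeq n x : ℝ) :=
          NNReal.continuous_coe.comp (hB'.apprSeq n).continuous
        let f : E →ᵇ ℝ := BoundedContinuousFunction.ofNormedAddCommGroup
          (fun x => (hB'.apprSeq n x : ℝ)) hcont 1 fun x => by
            rw [Real.norm_of_nonneg NNReal.zero_le_coe]
            exact_mod_cast HasOuterApproxClosed.apprSeq_apply_le_one hB' n x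
        have h2 : Measurable[starFiltration X hX t] (timeIntegral f X t) := by
          rw [measurable_iff_comap_le]
          exact le_sup_of_le_right (le_iSup₂_of_le t le_rfl (le_iSup_of_le f le_rfl))
        have h3 : (fun ω => ∫⁻ x, (hB'.apprSeq n x : ℝ≥0∞) ∂(O ω)) =
            fun ω => ENNReal.ofReal (timeIntegral f X t ω) := by
          funext ω
          rw [timeIntegral_eq_integral_map hX f.continuous.measurable,
            ofReal_integral_eq_lintegral_ofReal (f.integrable _)
              (Eventually.of_forall fun x => NNReal.zero_le_coe)]
          refine lintegral_congr fun x => ?_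
          exact (ENNReal.ofReal_coe_nnreal).symm
        rw [h3]
        exact ENNReal.measurable_ofReal.comp h2
      refine @measurable_of_tendsto_metrizable Ω _ (starFiltration X hX t) _ _ _ _ _ _ h1 ?_
      rw [tendsto_pi_nhds]
      intro ω
      exact HasOuterApproxClosed.tendsto_lintegral_apprSeq hB' (O ω)
    · have : (fun ω => O ω Set.univ) = fun _ => volume.restrict (Set.Ioc (0 : ℝ) t) Set.univ := by
        funext ω
        simp only [O]
        rw [Measure.map_apply (hXω ω) MeasurableSet.univ, Set.preimage_univ]
      rw [this]
      exact measurable_const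
  have h := @measurable_integral_measure Ω E (starFiltration X hX t) _ O hO g hg
  have e : timeIntegral g X t = fun ω => ∫ x, g x ∂(O ω) :=
    funext fun ω => timeIntegral_eq_integral_map hX hg t ω
  rw [e]
  exact h

theorem starFiltration_le_of_measurable {Ω : Type u} {m : MeasurableSpace Ω}
    [MeasurableSpace Ω] {X : ℝ≥0 → Ω → E} (hX : MeasurableProcess X) {t : ℝ≥0} (h1 : ∀ u ≤ t, Measurable[m] (X u))
    (h2 : ∀ u ≤ t, ∀ h : E →ᵇ ℝ, Measurable[m] (timeIntegral h X u)) :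
    starFiltration X hX t ≤ m :=
  sup_le (iSup₂_le fun u hu => measurable_iff_comap_le.1 (h1 u hu))
    (iSup₂_le fun u hu => iSup_le fun h => measurable_iff_comap_le.1 (h2 u hu h))

end Filtration


/-! ### The martingale identity and its stability under limits -/

section Compensated

variable {E : Type u} [MeasurableSpace E] {Ω : Type u} [MeasurableSpace Ω]

/-- The process `f(X_t) - ∫_0^t g(X_s) ds`. -/
noncomputable def compensated (f g : E → ℝ) (X : ℝ≥0 → Ω → E) (t : ℝ≥0) (ω : Ω) : ℝ :=
  f (X t ω) - timeIntegral g X t ω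

variable {Φ : E → ℝ≥0} {P : Measure Ω} {X : ℝ≥0 → Ω → E} [IsFiniteMeasure P]

theorem integrable_comp_of_bounded {f : E → ℝ} (hf : Measurable f) {K : ℝ}
    (hK : ∀ x, |f x| ≤ K) {Y : Ω → E} (hY : Measurable Y) : Integrable (fun ω => f (Y ω)) P :=
  Integrable.of_bound (hf.comp hY).aestronglyMeasurable K (Eventually.of_forall fun _ => hK _)

theorem integrable_compensated (hΦ : Measurable Φ) (hX : MeasurableProcess X)
    (hI : ExpectedIntegralFinite Φ P X) {f g : E → ℝ} (hf : Measurable f) {K : ℝ}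
    (hK : ∀ x, |f x| ≤ K) (hg : Measurable g) {C : ℝ} (hC : ∀ x, |g x| ≤ C * Φ x) (t : ℝ≥0) :
    Integrable (compensated f g X t) P :=
  (integrable_comp_of_bounded hf hK (hX.measurable t)).sub
    (hI.integrable_timeIntegral hΦ hX hg hC t)

theorem integral_compensated (hΦ : Measurable Φ) (hX : MeasurableProcess X)
    (hI : ExpectedIntegralFinite Φ P X) {f g : E → ℝ} (hf : Measurable f) {K : ℝ}
    (hK : ∀ x, |f x| ≤ K) (hg : Measurable g) {C : ℝ} (hC : ∀ x, |g x| ≤ C * Φ x) (t : ℝ≥0) :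
    ∫ ω, compensated f g X t ω ∂P = ∫ ω, f (X t ω) ∂P - ∫ ω, timeIntegral g X t ω ∂P :=
  integral_sub (integrable_comp_of_bounded hf hK (hX.measurable t))
    (hI.integrable_timeIntegral hΦ hX hg hC t)

/-- Dominated convergence, with `K` for the first term and `K * Φ` along the path for the time
integral. Dividing by `Φ` in `graphPair` is what makes bounded pointwise convergence sufficient
here. -/
theorem tendsto_integral_compensated (hΦ : Measurable Φ) (hX : MeasurableProcess X)
    (hI : ExpectedIntegralFinite Φ P X) {f g : ℕ → E → ℝ} {f' g' : E → ℝ}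
    (hf : ∀ n, Measurable (f n)) (hg : ∀ n, Measurable (g n)) {K : ℝ}
    (hK : ∀ n x, |f n x| ≤ K ∧ |g n x| ≤ K) (hf' : ∀ x, Tendsto (fun n => f n x) atTop (𝓝 (f' x)))
    (hg' : ∀ x, Tendsto (fun n => g n x) atTop (𝓝 (g' x))) (t : ℝ≥0) :
    Tendsto (fun n => ∫ ω, compensated (f n) (fun x => g n x * Φ x) X t ω ∂P) atTop
      (𝓝 (∫ ω, compensated f' (fun x => g' x * Φ x) X t ω ∂P)) := by
  have hΦ' : Measurable fun x => (Φ x : ℝ) := hΦ.coe_nnreal_real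
  have hfm : Measurable f' := measurable_of_tendsto_metrizable hf (tendsto_pi_nhds.2 hf')
  have hgm : Measurable g' := measurable_of_tendsto_metrizable hg (tendsto_pi_nhds.2 hg')
  have hfK : ∀ x, |f' x| ≤ K := fun x =>
    le_of_tendsto (hf' x).abs (Eventually.of_forall fun n => (hK n x).1)
  have hgK : ∀ x, |g' x| ≤ K := fun x =>
    le_of_tendsto (hg' x).abs (Eventually.of_forall fun n => (hK n x).2)
  have hmul : ∀ {h : E → ℝ}, (∀ x, |h x| ≤ K) → ∀ x, |h x * Φ x| ≤ K * Φ x := by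
    intro h hh x
    rw [abs_mul, abs_of_nonneg (Φ x).coe_nonneg]
    exact mul_le_mul_of_nonneg_right (hh x) (Φ x).coe_nonneg
  have hgn : ∀ n x, |g n x * Φ x| ≤ K * Φ x := fun n => hmul fun x => (hK n x).2
  have hgm' : Measurable fun x => g' x * Φ x := hgm.mul hΦ'
  have hgnm : ∀ n, Measurable fun x => g n x * Φ x := fun n => (hg n).mul hΦ'
  rw [integral_compensated hΦ hX hI hfm hfK hgm' (hmul hgK)]
  simp_rw [fun n => integral_compensated hΦ hX hI (hf n) (fun x => (hK n x).1)
    (hgnm n) (hgn n) t]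
  refine Tendsto.sub ?_ ?_
  · refine tendsto_integral_of_dominated_convergence (fun _ => K)
      (fun n => ((hf n).comp (hX.measurable t)).aestronglyMeasurable) (integrable_const K)
      (fun n => Eventually.of_forall fun ω => (hK n _).1)
      (Eventually.of_forall fun ω => hf' _)
  · rw [hI.integral_timeIntegral hΦ hX hgm' (hmul hgK)]
    simp_rw [fun n => hI.integral_timeIntegral hΦ hX (hgnm n) (hgn n) t]
    have hKΦ : Integrable (fun p : Ω × ℝ => K * (Φ (X p.2.toNNReal p.1) : ℝ))
        (P.prod (volume.restrict (Set.Ioc (0 : ℝ) t))) :=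
      (hI.integrable_prod hΦ hX hΦ' (C := 1) (fun x => by simp) t).const_mul K
    refine tendsto_integral_of_dominated_convergence _
      (fun n => ((hgnm n).comp hX.measurable_uncurry_real).aestronglyMeasurable) hKΦ
      (fun n => Eventually.of_forall fun p => hgn n _)
      (Eventually.of_forall fun p => (hg' _).mul_const _)

end Compensated

section Solutions

variable {E : Type u} [MetricSpace E] {Φ : E → ℝ≥0}

theorem abs_apply_le_norm (f : E →ᵇ ℝ) (x : E) : |f x| ≤ ‖f‖ := f.norm_coe_le_norm x

variable [MeasurableSpace E]

/-- Where `Φ` vanishes, domination forces `A f = 0`, in agreement with the value of division by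
zero. -/
theorem graphPair_snd_mul {A : MPOperator E} (hA1 : Dominated A Φ) (f : A.domain) :
    (fun x => (graphPair A Φ f).2 x * (Φ x : ℝ)) = A.toFun f := by
  funext x
  obtain ⟨C, hC⟩ := hA1 f
  by_cases h : (Φ x : ℝ) = 0
  · have h1 := hC x
    rw [h, mul_zero] at h1
    simp [graphPair, h, abs_nonpos_iff.1 h1]
  · simp [graphPair, h]

variable [BorelSpace E] {Ω : Type u} [MeasurableSpace Ω] {P : Measure Ω} {X : ℝ≥0 → Ω → E}
  [IsFiniteMeasure P]

/-- The martingale identity between two times on an event passes to the bp-closure. -/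
theorem integral_compensated_eq_of_bpClosure {A : MPOperator E} (hΦ : Measurable Φ)
    (hA1 : Dominated A Φ) (hX : MeasurableProcess X)
    (hI : ExpectedIntegralFinite Φ P X) {S : Set A.domain}
    (hS : Set.range (graphPair A Φ) ⊆ bpClosure (graphPair A Φ '' S)) {s t : ℝ≥0}
    (h : ∀ f ∈ S, ∫ ω, compensated (f : E →ᵇ ℝ) (A.toFun f) X s ω ∂P =
      ∫ ω, compensated (f : E →ᵇ ℝ) (A.toFun f) X t ω ∂P) (f : A.domain) :
    ∫ ω, compensated (f : E →ᵇ ℝ) (A.toFun f) X s ω ∂P =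
      ∫ ω, compensated (f : E →ᵇ ℝ) (A.toFun f) X t ω ∂P := by
  -- `V` contains the generators and is bp-closed, hence contains the bp-closure. As `P` is only
  -- assumed finite, the result applies to the restriction of a law to an event.
  let V : Set ((E → ℝ) × (E → ℝ)) := {p | Measurable p.1 ∧ Measurable p.2 ∧
    ∫ ω, compensated p.1 (fun x => p.2 x * Φ x) X s ω ∂P =
      ∫ ω, compensated p.1 (fun x => p.2 x * Φ x) X t ω ∂P}
  have hgen : graphPair A Φ '' S ⊆ V := by
    rintro _ ⟨f, hf, rfl⟩
    refine ⟨(f : E →ᵇ ℝ).continuous.measurable,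
      (A.measurable_toFun f).div hΦ.coe_nnreal_real, ?_⟩
    rw [graphPair_snd_mul hA1 f]
    exact h f hf
  have hcl : BPClosed V := by
    rintro v p hv ⟨K, hK⟩ hlim
    refine ⟨measurable_of_tendsto_metrizable (fun n => (hv n).1)
        (tendsto_pi_nhds.2 fun x => (hlim x).1),
      measurable_of_tendsto_metrizable (fun n => (hv n).2.1)
        (tendsto_pi_nhds.2 fun x => (hlim x).2), ?_⟩
    have h1 := fun r => tendsto_integral_compensated hΦ hX hI (fun n => (hv n).1)
      (fun n => (hv n).2.1) hK (fun x => (hlim x).1) (fun x => (hlim x).2) r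
    refine tendsto_nhds_unique (h1 s) ?_
    simp_rw [fun n => (hv n).2.2]
    exact h1 t
  have hmem : graphPair A Φ f ∈ V := hS ⟨f, rfl⟩ V ⟨hgen, hcl⟩
  have h2 := hmem.2.2
  rw [graphPair_snd_mul hA1 f] at h2
  exact h2

/-- For the first term, convergence in probability gives almost sure convergence along subsequences,
and `f` is bounded and continuous. -/
theorem continuous_integral_compensated (hΦ : Measurable Φ) (hX : MeasurableProcess X)
    (hc : ContinuousInProbability P X) (hI : ExpectedIntegralFinite Φ P X)
    (f : E →ᵇ ℝ) {g : E → ℝ} (hg : Measurable g) {C : ℝ} (hC : ∀ x, |g x| ≤ C * Φ x) :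
    Continuous fun t => ∫ ω, compensated f g X t ω ∂P := by
  simp_rw [fun t => integral_compensated hΦ hX hI f.continuous.measurable (abs_apply_le_norm f)
    hg hC t]
  refine Continuous.sub ?_ (hI.continuous_integral_timeIntegral hΦ hX hg hC)
  rw [continuous_iff_continuousAt]
  intro t
  refine tendsto_of_subseq_tendsto fun ns hns => ?_
  have h1 : TendstoInMeasure P (fun n => X (ns n)) atTop (X t) := fun ε hε => (hc t ε hε).comp hns
  obtain ⟨ms, -, hms⟩ := h1.exists_seq_tendsto_ae
  refine ⟨ms, ?_⟩
  refine tendsto_integral_of_dominated_convergence (fun _ => ‖f‖)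
    (fun n => (f.continuous.measurable.comp (hX.measurable _)).aestronglyMeasurable)
    (integrable_const _) (fun n => Eventually.of_forall fun ω => f.norm_coe_le_norm _) ?_
  filter_upwards [hms] with ω hω
  exact (f.continuous.tendsto _).comp hω

theorem IsSolution.setIntegral_eq {A : MPOperator E} {lam : Measure E}
    (h : IsSolution A Φ lam P X) (f : A.domain) {s t : ℝ≥0} (hst : s ≤ t) {F : Set Ω}
    (hF : MeasurableSet[starFiltration X h.measurable s] F) :
    ∫ ω in F, compensated (f : E →ᵇ ℝ) (A.toFun f) X s ω ∂P =
      ∫ ω in F, compensated (f : E →ᵇ ℝ) (A.toFun f) X t ω ∂P :=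
  (h.martingale f).setIntegral_eq hst hF

/-- Integrability and adaptedness come for free, the latter because time integrals of Borel
functions are adapted; only the identities on past events remain to be checked. -/
theorem isSolution_of_setIntegral_eq {A : MPOperator E} {lam : Measure E} (hΦ : Measurable Φ)
    (hA1 : Dominated A Φ) (hX : MeasurableProcess X) (h0 : P.map (X 0) = lam)
    (hI : ExpectedIntegralFinite Φ P X)
    (h : ∀ (f : A.domain) (s t : ℝ≥0), s ≤ t → ∀ F, MeasurableSet[starFiltration X hX s] F →
      ∫ ω in F, compensated (f : E →ᵇ ℝ) (A.toFun f) X s ω ∂P =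
        ∫ ω in F, compensated (f : E →ᵇ ℝ) (A.toFun f) X t ω ∂P) :
    IsSolution A Φ lam P X where
  measurable := hX
  law_zero := h0
  integrable := hI
  martingale := by
    intro f
    obtain ⟨C, hC⟩ := hA1 f
    have hint := fun t => integrable_compensated hΦ hX hI (f : E →ᵇ ℝ).continuous.measurable
      (abs_apply_le_norm _) (A.measurable_toFun f) hC t
    have had : ∀ t, Measurable[starFiltration X hX t]
        (compensated (f : E →ᵇ ℝ) (A.toFun f) X t) := fun t =>
      ((f : E →ᵇ ℝ).continuous.measurable.comp (measurable_starFiltration hX le_rfl)).sub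
        (measurable_timeIntegral_starFiltration hX (A.measurable_toFun f) t)
    refine ⟨fun t => (had t).stronglyMeasurable, fun s t hst => ?_⟩
    exact (ae_eq_condExp_of_forall_setIntegral_eq ((starFiltration X hX).le s) (hint t)
      (fun F _ _ => (hint s).integrableOn) (fun F hF _ => h f s t hst F hF)
      (had s).stronglyMeasurable.aestronglyMeasurable).symm

end Solutions


/-! ### Countable families of past events -/

section TestSets

variable {E : Type u} [MeasurableSpace E]

/-- The events depending on the rational times up to `t`. -/
@[reducible]
noncomputable def ratSigma (E : Type u) [MeasurableSpace E] (t : ℝ≥0) : MeasurableSpace (ℚ≥0 → E) :=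
  MeasurableSpace.comap (truncPath t) inferInstance

theorem ratSigma_le (t : ℝ≥0) : ratSigma E t ≤ MeasurableSpace.pi :=
  (measurable_truncPath t).comap_le

theorem ratSigma_mono {s t : ℝ≥0} (h : s ≤ t) : ratSigma E s ≤ ratSigma E t := by
  rintro _ ⟨B, hB, rfl⟩
  refine ⟨truncPath s ⁻¹' B, measurable_truncPath s hB, ?_⟩
  ext ω
  simp [truncPath_truncPath h]

theorem exists_countable_isPiSystem {α : Type*} (m : MeasurableSpace α)
    [h : MeasurableSpace.CountablyGenerated α] : ∃ b : Set (Set α), b.Countable ∧ IsPiSystem b ∧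
      Set.univ ∈ b ∧ m = MeasurableSpace.generateFrom b := by
  obtain ⟨c, hc, rfl⟩ := h.isCountablyGenerated
  have ha := isSetAlgebra_generateSetAlgebra (𝒜 := c)
  exact ⟨generateSetAlgebra c, countable_generateSetAlgebra hc,
    fun s hs t ht _ => ha.inter_mem hs ht, ha.univ_mem, generateFrom_generateSetAlgebra_eq.symm⟩

theorem exists_testSets [StandardBorelSpace E] (t : ℝ≥0) :
    ∃ b : Set (Set (ℚ≥0 → E)), b.Countable ∧ IsPiSystem b ∧
      Set.univ ∈ b ∧ ratSigma E t = MeasurableSpace.generateFrom b := by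
  have : @MeasurableSpace.CountablyGenerated _ (ratSigma E t) :=
    MeasurableSpace.CountablyGenerated.comap _
  exact @exists_countable_isPiSystem _ (ratSigma E t) this

/-- A countable π-system generating the events that depend on the rational times up to `t`. -/
def testSets (E : Type u) [MeasurableSpace E] [StandardBorelSpace E] (t : ℝ≥0) :
    Set (Set (ℚ≥0 → E)) := Classical.choose (exists_testSets (E := E) t)

variable [StandardBorelSpace E]

theorem countable_testSets (t : ℝ≥0) : (testSets E t).Countable :=
  (Classical.choose_spec (exists_testSets (E := E) t)).1

theorem isPiSystem_testSets (t : ℝ≥0) : IsPiSystem (testSets E t) :=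
  (Classical.choose_spec (exists_testSets (E := E) t)).2.1

theorem univ_mem_testSets (t : ℝ≥0) : Set.univ ∈ testSets E t :=
  (Classical.choose_spec (exists_testSets (E := E) t)).2.2.1

theorem ratSigma_eq_generateFrom (t : ℝ≥0) :
    ratSigma E t = MeasurableSpace.generateFrom (testSets E t) :=
  (Classical.choose_spec (exists_testSets (E := E) t)).2.2.2

theorem measurableSet_of_mem_testSets {t : ℝ≥0} {F : Set (ℚ≥0 → E)} (h : F ∈ testSets E t) :
    MeasurableSet[ratSigma E t] F := by
  rw [ratSigma_eq_generateFrom]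
  exact MeasurableSpace.measurableSet_generateFrom h

end TestSets

/-- Two functions whose integrals agree on a π-system containing the whole space have the same
integrals on the generated events. -/
theorem setIntegral_eq_of_isPiSystem {α : Type*} [mα : MeasurableSpace α] {μ : Measure α}
    {f g : α → ℝ} (hf : Integrable f μ) (hg : Integrable g μ) {m : MeasurableSpace α}
    (hm : m ≤ mα) {b : Set (Set α)} (hb : IsPiSystem b) (huniv : Set.univ ∈ b)
    (hgen : m = MeasurableSpace.generateFrom b)
    (h : ∀ F ∈ b, ∫ x in F, f x ∂μ = ∫ x in F, g x ∂μ) {F : Set α} (hF : MeasurableSet[m] F) :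
    ∫ x in F, f x ∂μ = ∫ x in F, g x ∂μ := by
  induction F, hF using MeasurableSpace.induction_on_inter hgen hb with
  | empty => simp
  | basic F hF => exact h F hF
  | compl F hF ih =>
    have h1 := h _ huniv
    simp only [Measure.restrict_univ] at h1
    have h2 := integral_add_compl (hm F hF) hf
    have h3 := integral_add_compl (hm F hF) hg
    linarith
  | iUnion F hd hF ih =>
    rw [integral_iUnion (fun i => hm _ (hF i)) hd hf.integrableOn,
      integral_iUnion (fun i => hm _ (hF i)) hd hg.integrableOn]
    exact tsum_congr ih

theorem expectedIntegralFinite_of_nat {E : Type u} {Ω : Type u} [MeasurableSpace Ω] {Φ : E → ℝ≥0}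
    {P : Measure Ω} {X : ℝ≥0 → Ω → E} (h : ∀ N : ℕ, ∫⁻ ω, (∫⁻ s in Set.Ioc (0 : ℝ) (N : ℝ),
      (Φ (X s.toNNReal ω) : ℝ≥0∞)) ∂P < ∞) : ExpectedIntegralFinite Φ P X := by
  intro T
  refine lt_of_le_of_lt (lintegral_mono fun ω => ?_) (h ⌈T⌉₊)
  refine lintegral_mono_set (Set.Ioc_subset_Ioc_right ?_)
  exact_mod_cast Nat.le_ceil T

theorem MeasurableProcess.comp_measurable {E : Type u} [MeasurableSpace E] {Ω : Type u}
    [MeasurableSpace Ω] {Ω' : Type u} [MeasurableSpace Ω'] {Y : ℝ≥0 → Ω' → E}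
    (hY : MeasurableProcess Y) {r : Ω → Ω'} (hr : Measurable r) :
    MeasurableProcess fun t ω => Y t (r ω) :=
  hY.comp (measurable_fst.prodMk (hr.comp measurable_snd))

theorem measurable_truncPath_ratPath {E : Type u} [MetricSpace E] [MeasurableSpace E]
    [BorelSpace E] {Ω : Type u} [MeasurableSpace Ω] {X : ℝ≥0 → Ω → E} (hX : MeasurableProcess X) (t : ℝ≥0) :
    Measurable[starFiltration X hX t] fun ω => truncPath t (ratPath X ω) := by
  refine @measurable_pi_lambda _ _ _ (starFiltration X hX t) _ _ fun q => ?_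
  by_cases hq : (q : ℝ≥0) ≤ t
  · simp only [truncPath, hq, if_true]
    exact measurable_starFiltration hX hq
  · simp only [truncPath, hq, if_false]
    have : (fun ω => ratPath X ω 0) = X 0 := by
      funext ω
      simp [ratPath]
    rw [this]
    exact measurable_starFiltration hX zero_le

/-! ### Solutions as laws on rational paths -/

section PathLaw

variable {E : Type u} [MetricSpace E] [MeasurableSpace E] [BorelSpace E]
  [SecondCountableTopology E] [CompleteSpace E] [Nonempty E]

/-- Up to time `t` the process and its time integrals factor through `truncPath t`. The filtration
is thus contained in a countably generated one. -/
theorem starFiltration_canonProcess_le (Q : Measure (ℚ≥0 → E)) (t : ℝ≥0) :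
    starFiltration (canonProcess Q) (measurableProcess_canonProcess Q) t ≤ ratSigma E t := by
  have hX := measurableProcess_canonProcess Q
  have htr : @Measurable _ _ (ratSigma E t) _ (truncPath (E := E) t) :=
    comap_measurable (truncPath t)
  refine starFiltration_le_of_measurable hX (fun u hu => ?_) (fun u hu h => ?_)
  · have : canonProcess Q u = canonProcess Q u ∘ truncPath t :=
      funext fun ω => (canonProcess_truncPath Q hu ω).symm
    rw [this]
    exact (hX.measurable u).comp htr
  · have : timeIntegral h (canonProcess Q) u = timeIntegral h (canonProcess Q) u ∘ truncPath t :=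
      funext fun ω => (timeIntegral_canonProcess_truncPath Q h hu ω).symm
    rw [this]
    exact (measurable_timeIntegral h.continuous.measurable hX u).comp htr

/-- Countably many conditions on a law on the space of paths over rational times that characterize
the laws of the solutions that are continuous in probability. -/
structure IsSolutionPathLaw (A : MPOperator E) (Φ : E → ℝ≥0) (S : Set A.domain)
    (Q : Measure (ℚ≥0 → E)) : Prop where
  hasModulus : HasModulus Q
  integrable : ∀ N : ℕ, ∫⁻ ω, (∫⁻ s in Set.Ioc (0 : ℝ) (N : ℝ),
    (Φ (canonProcess Q s.toNNReal ω) : ℝ≥0∞)) ∂Q < ∞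
  setIntegral_eq : ∀ f ∈ S, ∀ s t : ℚ≥0, s ≤ t → ∀ F ∈ testSets E s,
    ∫ ω in F, compensated (f : E →ᵇ ℝ) (A.toFun f) (canonProcess Q) s ω ∂Q =
      ∫ ω in F, compensated (f : E →ᵇ ℝ) (A.toFun f) (canonProcess Q) t ω ∂Q

variable {A : MPOperator E} {Φ : E → ℝ≥0} {S : Set A.domain}

/-- The countable conditions are extended in three steps: from test sets to all events of `ratSigma
E s` by the π-system argument, from `S` to the whole domain by bp-closure on each event, and from
rational to real times by continuity. -/
theorem IsSolutionPathLaw.isContSolution (hΦ : Measurable Φ) (hA1 : Dominated A Φ)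
    (hS : Set.range (graphPair A Φ) ⊆ bpClosure (graphPair A Φ '' S))
    {Q : Measure (ℚ≥0 → E)} [IsProbabilityMeasure Q] (hQ : IsSolutionPathLaw A Φ S Q) :
    IsContSolution A Φ (Q.map fun ω => ω 0) Q (canonProcess Q) := by
  have hX := measurableProcess_canonProcess Q
  have hc := hQ.hasModulus.continuousInProbability
  have hI : ExpectedIntegralFinite Φ Q (canonProcess Q) :=
    expectedIntegralFinite_of_nat hQ.integrable
  have hI' : ∀ F : Set (ℚ≥0 → E), ExpectedIntegralFinite Φ (Q.restrict F) (canonProcess Q) :=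
    fun F => hI.mono_measure Measure.restrict_le_self
  refine ⟨isSolution_of_setIntegral_eq hΦ hA1 hX ?_ hI fun f s t hst F hF => ?_, hc⟩
  · refine Measure.map_congr ?_
    have h0 := hQ.hasModulus.canonProcess_rat 0
    rw [NNRat.cast_zero] at h0
    exact h0
  have hrat : ∀ (s t : ℚ≥0), s ≤ t → ∀ F, MeasurableSet[ratSigma E s] F →
      ∫ ω in F, compensated (f : E →ᵇ ℝ) (A.toFun f) (canonProcess Q) s ω ∂Q =
        ∫ ω in F, compensated (f : E →ᵇ ℝ) (A.toFun f) (canonProcess Q) t ω ∂Q := by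
    intro s t hst F hF
    refine integral_compensated_eq_of_bpClosure hΦ hA1 hX (hI' F) hS (fun f hf => ?_) f
    obtain ⟨C, hC⟩ := hA1 f
    have hint := fun t => integrable_compensated hΦ hX hI (f : E →ᵇ ℝ).continuous.measurable
      (abs_apply_le_norm _) (A.measurable_toFun f) hC t
    exact setIntegral_eq_of_isPiSystem (hint s) (hint t) (ratSigma_le _)
      (isPiSystem_testSets _) (univ_mem_testSets _) (ratSigma_eq_generateFrom _)
      (hQ.setIntegral_eq f hf s t hst) hF
  obtain ⟨C, hC⟩ := hA1 f
  have hF' := starFiltration_canonProcess_le Q s F hF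
  have hcF : ContinuousInProbability (Q.restrict F) (canonProcess Q) := fun r ε hε =>
    tendsto_of_tendsto_of_tendsto_of_le_of_le tendsto_const_nhds (hc r ε hε) (fun _ => zero_le)
      fun _ => Measure.restrict_apply_le _ _
  have hcont := continuous_integral_compensated hΦ hX hcF (hI' F) (f : E →ᵇ ℝ)
    (A.measurable_toFun f) hC
  have hdense : ∀ r r' : ℝ≥0, r < r' → ∃ q : ℚ≥0, r < q ∧ (q : ℝ≥0) < r' := by
    intro r r' h
    obtain ⟨q, hq, h1, h2⟩ := NNReal.lt_iff_exists_rat_btwn r r' |>.1 h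
    lift q to ℚ≥0 using hq
    have e : Real.toNNReal ((q : ℚ) : ℝ) = (q : ℝ≥0) := by
      have e' : ((q : ℚ) : ℝ) = ((q : ℝ≥0) : ℝ) := rfl
      rw [e', Real.toNNReal_coe]
    rw [e] at h1 h2
    exact ⟨q, h1, h2⟩
  -- An event of the past of `s` lies in the past of every rational time after `s`, so all these
  -- times share the value at a reference time `q₀`. Approaching from the right extends this to
  -- every real time from `s` on, including `s` itself.
  obtain ⟨q₀, hq₀, -⟩ := hdense s (s + 1) (lt_add_of_pos_right s one_pos)
  have hconst : ∀ q : ℚ≥0, s < q →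
      ∫ ω in F, compensated (f : E →ᵇ ℝ) (A.toFun f) (canonProcess Q) q ω ∂Q =
        ∫ ω in F, compensated (f : E →ᵇ ℝ) (A.toFun f) (canonProcess Q) q₀ ω ∂Q := by
    intro q hq
    rcases le_total q q₀ with h | h
    · exact hrat q q₀ h F (ratSigma_mono hq.le F hF')
    · exact (hrat q₀ q h F (ratSigma_mono hq₀.le F hF')).symm
  have hall : ∀ r, s ≤ r →
      ∫ ω in F, compensated (f : E →ᵇ ℝ) (A.toFun f) (canonProcess Q) r ω ∂Q =
        ∫ ω in F, compensated (f : E →ᵇ ℝ) (A.toFun f) (canonProcess Q) q₀ ω ∂Q := by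
    intro r hr
    by_contra hne
    have hopen := hcont.isOpen_preimage _ (isOpen_compl_singleton (x :=
      ∫ ω in F, compensated (f : E →ᵇ ℝ) (A.toFun f) (canonProcess Q) q₀ ω ∂Q))
    have hev := (hopen.mem_nhds hne : _ ∈ 𝓝 r)
    obtain ⟨r', hr', hsub⟩ := exists_Ico_subset_of_mem_nhds hev
      ⟨r + 1, lt_add_of_pos_right r one_pos⟩
    obtain ⟨q, hq1, hq2⟩ := hdense r r' hr'
    exact hsub ⟨hq1.le, hq2⟩ (hconst q (hr.trans_lt hq1))
  rw [hall s le_rfl, hall t hst]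

theorem HasModulus.map_ratPath {Q : Measure (ℚ≥0 → E)} [IsProbabilityMeasure Q]
    (hQ : HasModulus Q) : Q.map (ratPath (canonProcess Q)) = Q := by
  have h : ratPath (canonProcess Q) =ᵐ[Q] id := by
    filter_upwards [ae_all_iff.2 hQ.canonProcess_rat] with ω hω
    exact funext hω
  rw [Measure.map_congr h, Measure.map_id]

variable {Ω : Type u} [MeasurableSpace Ω] {P : Measure Ω} [IsProbabilityMeasure P]
  {X : ℝ≥0 → Ω → E} {lam : Measure E}

theorem fdd_canonProcess (hX : ∀ t, Measurable (X t)) (hc : ContinuousInProbability P X) :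
    fdd (P.map (ratPath X)) (canonProcess (P.map (ratPath X))) = fdd P X := by
  funext m t
  simp only [fdd]
  rw [Measure.map_map (measurable_pi_lambda _ fun i =>
    (measurableProcess_canonProcess _).measurable (t i)) (measurable_ratPath hX)]
  refine Measure.map_congr ?_
  filter_upwards [ae_all_iff.2 fun i => canonProcess_ratPath hX hc (t i)] with ω hω
  exact funext hω

/-- Evaluated along the rational paths of `X`, the canonical process is a modification of `X`, so
expectations and time integrals agree. A test set is a preimage under `truncPath s`, hence pulls
back to an event in the past of `X` at `s`. -/
theorem IsContSolution.isSolutionPathLaw (hΦ : Measurable Φ) (h : IsContSolution A Φ lam P X)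
    (S : Set A.domain) : IsSolutionPathLaw A Φ S (P.map (ratPath X)) := by
  have hX := h.1.measurable
  have hr := measurable_ratPath hX.measurable
  have hY := measurableProcess_canonProcess (P.map (ratPath X))
  have hmod := canonProcess_ratPath hX.measurable h.2
  have hYr := hY.comp_measurable hr
  refine ⟨.of_continuousInProbability hX.measurable h.2, fun N => ?_, fun f hf s t hst F hF => ?_⟩
  · have hm : Measurable fun ω => ∫⁻ s in Set.Ioc (0 : ℝ) (N : ℝ),
        (Φ (canonProcess (P.map (ratPath X)) s.toNNReal ω) : ℝ≥0∞) :=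
      (hΦ.comp hY.measurable_uncurry_real).coe_nnreal_ennreal.lintegral_prod_right'
    rw [lintegral_map hm hr]
    have h1 := lintegral_occupation_eq_of_modification hYr hX hmod Φ N
    have h2 := h.1.integrable N
    rw [← h1] at h2
    exact_mod_cast h2
  · obtain ⟨B, hB, rfl⟩ := measurableSet_of_mem_testSets hF
    have hF0 : MeasurableSet (truncPath (E := E) s ⁻¹' B) := measurable_truncPath _ hB
    have hpre : MeasurableSet[starFiltration X hX s] (ratPath X ⁻¹' (truncPath (E := E) s ⁻¹' B)) :=
      measurable_truncPath_ratPath hX s hB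
    have key : ∀ r : ℝ≥0, ∫ ω in truncPath (E := E) s ⁻¹' B, compensated (f : E →ᵇ ℝ) (A.toFun f)
        (canonProcess (P.map (ratPath X))) r ω ∂(P.map (ratPath X)) =
        ∫ ω in ratPath X ⁻¹' (truncPath (E := E) s ⁻¹' B),
          compensated (f : E →ᵇ ℝ) (A.toFun f) X r ω ∂P := by
      intro r
      have hm : Measurable (compensated (f : E →ᵇ ℝ) (A.toFun f)
          (canonProcess (P.map (ratPath X))) r) :=
        ((f : E →ᵇ ℝ).continuous.measurable.comp (hY.measurable r)).sub
          (measurable_timeIntegral (A.measurable_toFun f) hY r)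
      rw [setIntegral_map hF0 hm.aestronglyMeasurable hr.aemeasurable]
      refine integral_congr_ae (ae_restrict_of_ae ?_)
      filter_upwards [hmod r, timeIntegral_ae_eq_of_modification hYr hX hmod (A.toFun f) r]
        with ω h1 h2
      simp only [compensated]
      rw [h1, ← h2]
      rfl
    rw [key, key]
    exact h.1.setIntegral_eq f (by exact_mod_cast hst) hpre

end PathLaw

/-! ### The set of solution laws is Borel -/

section Measurability

variable {E : Type u} [MetricSpace E] [MeasurableSpace E] [BorelSpace E]
  [SecondCountableTopology E] [CompleteSpace E] [Nonempty E] {W : Type*} [MeasurableSpace W]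
  {A : MPOperator E} {Φ : E → ℝ≥0} {S : Set A.domain}

theorem measurable_canonProcess_kernel (κ : Kernel W (ℚ≥0 → E)) :
    Measurable fun p : (W × (ℚ≥0 → E)) × ℝ≥0 => canonProcess (κ p.1.1) p.2 p.1.2 := by
  have h : Measurable fun p : (W × (ℚ≥0 → E)) × ℝ≥0 => (κ p.1.1, p.2, p.1.2) :=
    (κ.measurable.comp measurable_fst.fst).prodMk (measurable_snd.prodMk measurable_fst.snd)
  have h' := measurable_canonProcess.comp h
  exact h'

theorem measurable_canonProcess_kernel_real (κ : Kernel W (ℚ≥0 → E)) :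
    Measurable fun p : (W × (ℚ≥0 → E)) × ℝ => canonProcess (κ p.1.1) p.2.toNNReal p.1.2 := by
  have h : Measurable fun p : (W × (ℚ≥0 → E)) × ℝ => (p.1, p.2.toNNReal) :=
    measurable_fst.prodMk (measurable_real_toNNReal.comp measurable_snd)
  have h' := (measurable_canonProcess_kernel κ).comp h
  exact h'

theorem measurable_canonProcess_kernel_apply (κ : Kernel W (ℚ≥0 → E)) (t : ℝ≥0) :
    Measurable fun p : W × (ℚ≥0 → E) => canonProcess (κ p.1) t p.2 := by
  have h : Measurable fun p : W × (ℚ≥0 → E) => (p, t) := measurable_id.prodMk measurable_const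
  have h' := (measurable_canonProcess_kernel κ).comp h
  exact h'

theorem measurable_lintegral_canonProcess_kernel (hΦ : Measurable Φ) (κ : Kernel W (ℚ≥0 → E))
    [IsSFiniteKernel κ] (T : ℝ) : Measurable fun w => ∫⁻ ω, (∫⁻ s in Set.Ioc (0 : ℝ) T,
      (Φ (canonProcess (κ w) s.toNNReal ω) : ℝ≥0∞)) ∂(κ w) := by
  have h : Measurable fun p : (W × (ℚ≥0 → E)) × ℝ =>
      (Φ (canonProcess (κ p.1.1) p.2.toNNReal p.1.2) : ℝ≥0∞) :=
    (hΦ.comp (measurable_canonProcess_kernel_real κ)).coe_nnreal_ennreal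
  exact (h.lintegral_prod_right'
    (ν := volume.restrict (Set.Ioc (0 : ℝ) T))).lintegral_kernel_prod_right'

theorem measurable_setIntegral_compensated_kernel (κ : Kernel W (ℚ≥0 → E)) [IsSFiniteKernel κ]
    {f g : E → ℝ} (hf : Measurable f) (hg : Measurable g) (t : ℝ≥0) {F : Set (ℚ≥0 → E)}
    (hF : MeasurableSet F) :
    Measurable fun w => ∫ ω in F, compensated f g (canonProcess (κ w)) t ω ∂(κ w) := by
  have h1 : Measurable fun p : (W × (ℚ≥0 → E)) × ℝ =>
      g (canonProcess (κ p.1.1) p.2.toNNReal p.1.2) :=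
    hg.comp (measurable_canonProcess_kernel_real κ)
  have h2 : Measurable fun p : W × (ℚ≥0 → E) => compensated f g (canonProcess (κ p.1)) t p.2 :=
    (hf.comp (measurable_canonProcess_kernel_apply κ t)).sub
      (h1.stronglyMeasurable.integral_prod_right'
        (ν := volume.restrict (Set.Ioc (0 : ℝ) (t : ℝ)))).measurable
  have h3 := (h2.indicator (measurable_snd hF)).stronglyMeasurable.integral_kernel_prod_right'
    (κ := κ)
  have h4 : (fun w => ∫ ω in F, compensated f g (canonProcess (κ w)) t ω ∂(κ w)) = fun w =>
      ∫ ω, (Prod.snd ⁻¹' F).indicator (fun p : W × (ℚ≥0 → E) =>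
        compensated f g (canonProcess (κ p.1)) t p.2) (w, ω) ∂(κ w) := by
    funext w
    rw [← integral_indicator hF]
    rfl
  rw [h4]
  exact h3.measurable

theorem measurableSet_isSolutionPathLaw (hΦ : Measurable Φ) (hS : S.Countable)
    (κ : Kernel W (ℚ≥0 → E)) [IsSFiniteKernel κ] :
    MeasurableSet {w | IsSolutionPathLaw A Φ S (κ w)} := by
  have : {w | IsSolutionPathLaw A Φ S (κ w)} = {w | HasModulus (κ w)} ∩
      (⋂ N : ℕ, {w | ∫⁻ ω, (∫⁻ s in Set.Ioc (0 : ℝ) (N : ℝ),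
        (Φ (canonProcess (κ w) s.toNNReal ω) : ℝ≥0∞)) ∂(κ w) < ∞}) ∩
      ⋂ f ∈ S, ⋂ (s : ℚ≥0) (t : ℚ≥0) (_ : s ≤ t), ⋂ F ∈ testSets E s,
        {w | ∫ ω in F, compensated (f : E →ᵇ ℝ) (A.toFun f) (canonProcess (κ w)) s ω ∂(κ w) =
          ∫ ω in F, compensated (f : E →ᵇ ℝ) (A.toFun f) (canonProcess (κ w)) t ω ∂(κ w)} := by
    ext w
    simp only [Set.mem_inter_iff, Set.mem_iInter, Set.mem_ofPred_eq]
    exact ⟨fun h => ⟨⟨h.1, h.2⟩, h.3⟩, fun h => ⟨h.1.1, h.1.2, h.2⟩⟩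
  rw [this]
  have h1 : MeasurableSet {w | HasModulus (κ w)} := κ.measurable measurableSet_hasModulus
  have h2 : ∀ N : ℕ, MeasurableSet {w | ∫⁻ ω, (∫⁻ s in Set.Ioc (0 : ℝ) (N : ℝ),
      (Φ (canonProcess (κ w) s.toNNReal ω) : ℝ≥0∞)) ∂(κ w) < ∞} := fun N =>
    measurableSet_lt (measurable_lintegral_canonProcess_kernel hΦ κ _) measurable_const
  have h3 : ∀ (f : A.domain) (s t : ℚ≥0), ∀ F ∈ testSets E s, MeasurableSet
      {w | ∫ ω in F, compensated (f : E →ᵇ ℝ) (A.toFun f) (canonProcess (κ w)) s ω ∂(κ w) =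
        ∫ ω in F, compensated (f : E →ᵇ ℝ) (A.toFun f) (canonProcess (κ w)) t ω ∂(κ w)} := by
    intro f s t F hF
    have hF' : MeasurableSet F := ratSigma_le _ _ (measurableSet_of_mem_testSets hF)
    have hm := fun r : ℝ≥0 => measurable_setIntegral_compensated_kernel κ
      (f : E →ᵇ ℝ).continuous.measurable (A.measurable_toFun f) r hF'
    exact measurableSet_eq_fun (hm s) (hm t)
  refine (h1.inter (MeasurableSet.iInter h2)).inter ?_
  refine MeasurableSet.biInter hS fun f _ => ?_
  refine MeasurableSet.iInter fun s => MeasurableSet.iInter fun t => MeasurableSet.iInter fun _ => ?_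
  exact MeasurableSet.biInter (countable_testSets _) fun F hF => h3 f s t F hF

end Measurability


/-! ### Conditioning on the past and restarting -/

section Shift

theorem preimage_const_add_Ioc_coe (s t : ℝ≥0) :
    (fun r : ℝ => (s : ℝ) + r) ⁻¹' Set.Ioc (s : ℝ) ((s + t : ℝ≥0) : ℝ) = Set.Ioc (0 : ℝ) t := by
  ext r
  simp

theorem toNNReal_const_add (s : ℝ≥0) {r : ℝ} (hr : 0 ≤ r) :
    ((s : ℝ) + r).toNNReal = s + r.toNNReal := by
  rw [Real.toNNReal_add s.coe_nonneg hr, Real.toNNReal_coe]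

theorem setIntegral_Ioc_shift {E : Type*} (g : E → ℝ) (x : ℝ≥0 → E) (s t : ℝ≥0) :
    ∫ r in Set.Ioc (0 : ℝ) t, g (x (s + r.toNNReal)) =
      ∫ r in Set.Ioc (s : ℝ) ((s + t : ℝ≥0) : ℝ), g (x r.toNNReal) := by
  rw [← (measurePreserving_add_left volume (s : ℝ)).setIntegral_preimage_emb
    (measurableEmbedding_addLeft (s : ℝ)) (fun r => g (x r.toNNReal)), preimage_const_add_Ioc_coe]
  refine setIntegral_congr_fun measurableSet_Ioc fun r hr => ?_
  simp only [toNNReal_const_add s hr.1.le]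

theorem setLIntegral_Ioc_shift_le {E : Type*} (g : E → ℝ≥0∞) (x : ℝ≥0 → E) (s t : ℝ≥0) :
    ∫⁻ r in Set.Ioc (0 : ℝ) t, g (x (s + r.toNNReal)) ≤
      ∫⁻ r in Set.Ioc (0 : ℝ) ((s + t : ℝ≥0) : ℝ), g (x r.toNNReal) := by
  have h : ∫⁻ r in Set.Ioc (0 : ℝ) t, g (x (s + r.toNNReal)) =
      ∫⁻ r in Set.Ioc (s : ℝ) ((s + t : ℝ≥0) : ℝ), g (x r.toNNReal) := by
    rw [← (measurePreserving_add_left volume (s : ℝ)).setLIntegral_comp_preimage_emb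
      (measurableEmbedding_addLeft (s : ℝ)) (fun r => g (x r.toNNReal)),
      preimage_const_add_Ioc_coe]
    refine setLIntegral_congr_fun measurableSet_Ioc fun r hr => ?_
    simp only [toNNReal_const_add s hr.1.le]
  rw [h]
  exact lintegral_mono_set (Set.Ioc_subset_Ioc_left s.coe_nonneg)

theorem timeIntegral_shift {E : Type u} {Ω : Type u} [MeasurableSpace E] [MeasurableSpace Ω]
    {g : E → ℝ} {X : ℝ≥0 → Ω → E} {s t : ℝ≥0} {ω : Ω}
    (h : IntegrableOn (fun r : ℝ => g (X r.toNNReal ω)) (Set.Ioc (0 : ℝ) ((s + t : ℝ≥0) : ℝ))) :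
    timeIntegral g (fun r => X (s + r)) t ω = timeIntegral g X (s + t) ω - timeIntegral g X s ω := by
  have hst : (s : ℝ) ≤ ((s + t : ℝ≥0) : ℝ) := NNReal.coe_le_coe.2 le_self_add
  unfold timeIntegral
  rw [setIntegral_Ioc_shift g (fun r => X r ω) s t, ← Set.Ioc_union_Ioc_eq_Ioc s.coe_nonneg hst,
    setIntegral_union (Set.Ioc_disjoint_Ioc_of_le le_rfl) measurableSet_Ioc
    (h.mono_set (Set.Ioc_subset_Ioc_right hst)) (h.mono_set (Set.Ioc_subset_Ioc_left s.coe_nonneg))]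
  ring

theorem MeasurableProcess.shift {E : Type u} {Ω : Type u} [MeasurableSpace E] [MeasurableSpace Ω]
    {X : ℝ≥0 → Ω → E} (hX : MeasurableProcess X) (s : ℝ≥0) :
    MeasurableProcess fun t => X (s + t) :=
  hX.comp ((measurable_const.add measurable_fst).prodMk measurable_snd)

variable {E : Type u} [MetricSpace E] [MeasurableSpace E] [BorelSpace E]
  {Ω : Type u} [MeasurableSpace Ω] {X : ℝ≥0 → Ω → E}

/-- A time integral of the shifted process is a difference of two time integrals of `X`. -/
theorem starFiltration_shift_le (hX : MeasurableProcess X) (s t : ℝ≥0) :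
    starFiltration (fun t => X (s + t)) (hX.shift s) t ≤ starFiltration X hX (s + t) := by
  refine starFiltration_le_of_measurable (hX.shift s)
    (fun u hu => measurable_starFiltration hX (add_le_add_right hu s)) fun u hu h => ?_
  have h1 : timeIntegral h (fun t => X (s + t)) u =
      fun ω => timeIntegral h X (s + u) ω - timeIntegral h X s ω := by
    funext ω
    refine timeIntegral_shift (Integrable.of_bound ?_ ‖h‖ (Eventually.of_forall fun r =>
      h.norm_coe_le_norm _))
    exact (h.continuous.measurable.comp
      (hX.measurable_uncurry_real.comp measurable_prodMk_left)).aestronglyMeasurable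
  rw [h1]
  have hsu : s + u ≤ s + t := add_le_add_right hu s
  exact ((measurable_timeIntegral_starFiltration hX h.continuous.measurable (s + u)).mono
    ((starFiltration X hX).mono hsu) le_rfl).sub
    ((measurable_timeIntegral_starFiltration hX h.continuous.measurable s).mono
    ((starFiltration X hX).mono le_self_add) le_rfl)

/-- A solution started afresh at time `s`, conditionally on an event of the past, is a solution. -/
theorem IsContSolution.shift_cond {A : MPOperator E} {Φ : E → ℝ≥0} {lam : Measure E}
    {P : Measure Ω} [IsProbabilityMeasure P] (hΦ : Measurable Φ) (hA1 : Dominated A Φ)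
    (h : IsContSolution A Φ lam P X) (s : ℝ≥0) {F : Set Ω}
    (hF : MeasurableSet[starFiltration X h.1.measurable s] F) (hPF : P F ≠ 0) :
    IsContSolution A Φ (P[|F].map (X s)) P[|F] fun t => X (s + t) := by
  have hX := h.1.measurable
  have hI : ExpectedIntegralFinite Φ P X := h.1.integrable
  have hF' : MeasurableSet F := (starFiltration X hX).le s F hF
  have hprob : IsProbabilityMeasure P[|F] := cond_isProbabilityMeasure hPF
  have hle : ∀ B, P[|F] B ≤ (P F)⁻¹ * P B := fun B => by
    rw [cond_apply hF']
    gcongr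
    exact Set.inter_subset_right
  have hIY : ExpectedIntegralFinite Φ P[|F] fun t => X (s + t) := by
    intro T
    calc ∫⁻ ω, (∫⁻ r in Set.Ioc (0 : ℝ) (T : ℝ), (Φ (X (s + r.toNNReal) ω) : ℝ≥0∞)) ∂P[|F]
        ≤ ∫⁻ ω, (∫⁻ r in Set.Ioc (0 : ℝ) ((s + T : ℝ≥0) : ℝ),
            (Φ (X r.toNNReal ω) : ℝ≥0∞)) ∂P[|F] :=
          lintegral_mono fun ω => setLIntegral_Ioc_shift_le (fun x => (Φ x : ℝ≥0∞))
            (fun r => X r ω) s T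
      _ = (P F)⁻¹ * ∫⁻ ω in F, (∫⁻ r in Set.Ioc (0 : ℝ) ((s + T : ℝ≥0) : ℝ),
            (Φ (X r.toNNReal ω) : ℝ≥0∞)) ∂P := by
          rw [ProbabilityTheory.cond, lintegral_smul_measure, smul_eq_mul]
      _ < ∞ := ENNReal.mul_lt_top (ENNReal.inv_lt_top.2 (pos_iff_ne_zero.2 hPF))
          ((setLIntegral_le_lintegral _ _).trans_lt (hI (s + T)))
  refine ⟨isSolution_of_setIntegral_eq hΦ hA1 (hX.shift s) (by simp) hIY
    fun f t t' htt' G hG => ?_, fun t ε hε => ?_⟩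
  · obtain ⟨C, hC⟩ := hA1 f
    have hG' : MeasurableSet[starFiltration X hX (s + t)] G := starFiltration_shift_le hX s t G hG
    have hGm : MeasurableSet G := (starFiltration X hX).le _ G hG'
    have hGF : MeasurableSet[starFiltration X hX (s + t)] (G ∩ F) :=
      hG'.inter ((starFiltration X hX).mono le_self_add F hF)
    have hfm := (f : E →ᵇ ℝ).continuous.measurable
    -- Restarting changes the compensated process by the time integral up to `s`, which does not
    -- depend on `r`, and conditioning only rescales; both sides of the martingale identity change
    -- alike.
    have key : ∀ r, ∫ ω in G, compensated (f : E →ᵇ ℝ) (A.toFun f) (fun t => X (s + t)) r ω ∂P[|F] =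
        (P F)⁻¹.toReal • (∫ ω in G ∩ F, compensated (f : E →ᵇ ℝ) (A.toFun f) X (s + r) ω ∂P +
          ∫ ω in G ∩ F, timeIntegral (A.toFun f) X s ω ∂P) := by
      intro r
      rw [ProbabilityTheory.cond, Measure.restrict_smul, integral_smul_measure,
        Measure.restrict_restrict hGm, ← integral_add
        (integrable_compensated hΦ hX hI hfm (abs_apply_le_norm _) (A.measurable_toFun f) hC
          (s + r)).integrableOn
        (hI.integrable_timeIntegral hΦ hX (A.measurable_toFun f) hC s).integrableOn]
      congr 1
      refine integral_congr_ae (ae_restrict_of_ae ?_)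
      filter_upwards [hI.ae_integrableOn hΦ hX (A.measurable_toFun f) hC (s + r)] with ω hω
      simp only [compensated]
      rw [timeIntegral_shift hω]
      ring
    rw [key, key, h.1.setIntegral_eq f (add_le_add_right htt' s) hGF]
  · have h1 : Tendsto (fun r => (P F)⁻¹ * P {ω | ε ≤ edist (X (s + r) ω) (X (s + t) ω)})
        (𝓝 t) (𝓝 0) := by
      have h2 := ENNReal.Tendsto.const_mul (a := (P F)⁻¹)
        ((h.2 (s + t) ε hε).comp ((continuous_const.add continuous_id).tendsto t))
        (Or.inr (ENNReal.inv_ne_top.2 hPF))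
      simpa using h2
    exact tendsto_of_tendsto_of_tendsto_of_le_of_le tendsto_const_nhds h1 (fun _ => zero_le)
      fun _ => hle _

end Shift


/-- A law on the product over rational times is the projective limit of its finite marginals, so
uniqueness of finite-dimensional distributions becomes uniqueness of path laws. -/
theorem map_ratPath_eq_of_fdd_eq {E : Type u} [MetricSpace E] [MeasurableSpace E]
    {Ω Ω' : Type u} [MeasurableSpace Ω] [MeasurableSpace Ω']
    {P : Measure Ω} {P' : Measure Ω'} [IsProbabilityMeasure P] {X : ℝ≥0 → Ω → E}
    {X' : ℝ≥0 → Ω' → E} (hX : ∀ t, Measurable (X t)) (hX' : ∀ t, Measurable (X' t))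
    (h : fdd P X = fdd P' X') : P.map (ratPath X) = P'.map (ratPath X') := by
  have hproj : ∀ {Ω : Type u} [MeasurableSpace Ω] {P : Measure Ω} {X : ℝ≥0 → Ω → E},
      (∀ t, Measurable (X t)) → ∀ I : Finset ℚ≥0, P.map (fun ω => I.restrict (ratPath X ω)) =
        (fdd P X I.card fun k => ((I.equivFin.symm k : ℚ≥0) : ℝ≥0)).map
          fun v i => v (I.equivFin i) := by
    intro Ω _ P X hX I
    rw [fdd, Measure.map_map (measurable_pi_lambda _ fun i => measurable_pi_apply _)
      (measurable_pi_lambda _ fun i => hX _)]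
    congr 1
    funext ω i
    simp [ratPath]
  have h1 := isProjectiveLimit_map (P := P) (X := fun (q : ℚ≥0) => X q)
    (measurable_ratPath hX).aemeasurable
  have h2 := isProjectiveLimit_map (P := P') (X := fun (q : ℚ≥0) => X' q)
    (measurable_ratPath hX').aemeasurable
  have h3 : (fun I : Finset ℚ≥0 => P.map (fun ω => I.restrict fun q : ℚ≥0 => X q ω)) =
      fun I : Finset ℚ≥0 => P'.map (fun ω => I.restrict fun q : ℚ≥0 => X' q ω) := by
    funext I
    exact (hproj hX I).trans ((by rw [h]) : _) |>.trans (hproj hX' I).symm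
  rw [← h3] at h2
  exact h1.unique h2

/-- Rewrites the initial condition as a null event, which is visibly Borel jointly in the starting
point and the law. -/
theorem map_eq_dirac_iff {E : Type*} [MeasurableSpace E] [MeasurableSingletonClass E] {Ω : Type*} [MeasurableSpace Ω] {P : Measure Ω} [IsProbabilityMeasure P]
    {Y : Ω → E} (hY : Measurable Y) (x : E) :
    P.map Y = Measure.dirac x ↔ P {ω | Y ω ≠ x} = 0 := by
  have hm : MeasurableSet {y : E | y ≠ x} := (measurableSet_singleton x).compl
  constructor
  · intro h
    have h1 : P.map Y {y | y ≠ x} = 0 := by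
      rw [h, Measure.dirac_apply' _ hm]
      simp
    rwa [Measure.map_apply hY hm] at h1
  · intro h
    have h1 : Y =ᵐ[P] fun _ => x := h
    rw [Measure.map_congr h1, Measure.map_const]
    simp

/-! ### Measurable dependence on the starting point -/

section DegenerateLaws

variable {E : Type u} [MetricSpace E] [MeasurableSpace E] [BorelSpace E]
  {A : MPOperator E} {Φ : E → ℝ≥0}

theorem DegenerateWellPosed.exists_ratPath_law (h : DegenerateWellPosed A Φ) (x : E) :
    ∃ Q : Measure (ℚ≥0 → E), ∃ (Ω : Type u) (_ : MeasurableSpace Ω) (P : Measure Ω)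
      (_ : IsProbabilityMeasure P) (X : ℝ≥0 → Ω → E),
      IsContSolution A Φ (Measure.dirac x) P X ∧ fdd P X = degLaw h x ∧ P.map (ratPath X) = Q := by
  obtain ⟨Ω, i, P, hP, X, hX, he⟩ := (degLaw_eq_iff h x _).2 rfl
  exact ⟨_, Ω, i, P, hP, X, hX, he, rfl⟩

/-- The law, on the space of paths over rational times, of the solution started at `x`. -/
noncomputable def pathLaw (h : DegenerateWellPosed A Φ) (x : E) : Measure (ℚ≥0 → E) :=
  Classical.choose (h.exists_ratPath_law x)

theorem pathLaw_map_zero (h : DegenerateWellPosed A Φ) (x : E) :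
    (pathLaw h x).map (fun ω => ω 0) = Measure.dirac x := by
  obtain ⟨Ω, i, P, hP, X, hX, he', he⟩ := Classical.choose_spec (h.exists_ratPath_law x)
  rw [pathLaw, ← he, Measure.map_map (measurable_pi_apply 0)
    (measurable_ratPath hX.1.measurable.measurable), ← hX.1.law_zero]
  congr 1
  funext ω
  simp [ratPath]

variable [SecondCountableTopology E] [CompleteSpace E]

instance isProbabilityMeasure_pathLaw (h : DegenerateWellPosed A Φ) (x : E) :
    IsProbabilityMeasure (pathLaw h x) := by
  obtain ⟨Ω, i, P, hP, X, hX, -, he⟩ := Classical.choose_spec (h.exists_ratPath_law x)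
  rw [pathLaw, ← he]
  exact Measure.isProbabilityMeasure_map (measurable_ratPath hX.1.measurable.measurable).aemeasurable

variable [Nonempty E]

theorem fdd_pathLaw (h : DegenerateWellPosed A Φ) (x : E) :
    fdd (pathLaw h x) (canonProcess (pathLaw h x)) = degLaw h x := by
  obtain ⟨Ω, i, P, hP, X, hX, he', he⟩ := Classical.choose_spec (h.exists_ratPath_law x)
  rw [pathLaw, ← he, ← he']
  exact fdd_canonProcess hX.1.measurable.measurable hX.2

theorem isSolutionPathLaw_pathLaw (hΦ : Measurable Φ) (h : DegenerateWellPosed A Φ)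
    (S : Set A.domain) (x : E) : IsSolutionPathLaw A Φ S (pathLaw h x) := by
  obtain ⟨Ω, i, P, hP, X, hX, he', he⟩ := Classical.choose_spec (h.exists_ratPath_law x)
  rw [pathLaw, ← he]
  exact hX.isSolutionPathLaw hΦ S

theorem isContSolution_pathLaw (hΦ : Measurable Φ) (hA1 : Dominated A Φ)
    (h : DegenerateWellPosed A Φ) (x : E) :
    IsContSolution A Φ (Measure.dirac x) (pathLaw h x) (canonProcess (pathLaw h x)) := by
  rw [← pathLaw_map_zero h x]
  -- The whole domain bp-generates itself, and countability of the generating set plays no role at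
  -- this point.
  refine (isSolutionPathLaw_pathLaw hΦ h Set.univ x).isContSolution hΦ hA1 ?_
  rw [Set.image_univ]
  exact Set.subset_sInter fun V hV => hV.1

/-- Transfers (A3) to path laws: a law meeting the countable conditions yields a solution from `x`,
and its canonical process has path law `Q` again. -/
theorem pathLaw_unique (hΦ : Measurable Φ) (hA1 : Dominated A Φ) (h : DegenerateWellPosed A Φ)
    {S : Set A.domain} (hS : Set.range (graphPair A Φ) ⊆ bpClosure (graphPair A Φ '' S)) {x : E}
    {Q : Measure (ℚ≥0 → E)} [IsProbabilityMeasure Q] (hQ : IsSolutionPathLaw A Φ S Q)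
    (h0 : Q.map (fun ω => ω 0) = Measure.dirac x) : Q = pathLaw h x := by
  have h1 := hQ.isContSolution hΦ hA1 hS
  rw [h0] at h1
  have h2 := isContSolution_pathLaw hΦ hA1 h x
  have h3 := map_ratPath_eq_of_fdd_eq h1.1.measurable.measurable h2.1.measurable.measurable
    ((h x).2 _ _ _ _ _ _ h1 h2)
  rwa [hQ.hasModulus.map_ratPath,
    (isSolutionPathLaw_pathLaw hΦ h S x).hasModulus.map_ratPath] at h3

/-- Consider the pairs `(x, w)` for which `κ w` is a solution law started at `x`. They form a Borel
set; surjectivity of `κ` gives a `w` for each `x`, and `pathLaw_unique` makes `κ w` depend on `x`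
alone. -/
theorem measurable_pathLaw (hΦ : Measurable Φ) (hA1 : Dominated A Φ)
    (hA2 : CountablyBPGenerated A Φ) (h : DegenerateWellPosed A Φ) : Measurable (pathLaw h) := by
  obtain ⟨S, hSc, hS⟩ := hA2
  obtain ⟨κ, hκ, hsurj⟩ := exists_surjective_markovKernel (ℚ≥0 → E)
  have hset : MeasurableSet {p : E × (ℚ → ℝ) | κ p.2 {ω | ω 0 ≠ p.1} = 0} := by
    have h0 : Measurable fun p : (E × (ℚ → ℝ)) × (ℚ≥0 → E) => p.2 0 :=
      (measurable_pi_apply 0).comp measurable_snd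
    have h1 : MeasurableSet {p : (E × (ℚ → ℝ)) × (ℚ≥0 → E) | p.2 0 ≠ p.1.1} :=
      (measurableSet_eq_fun h0 measurable_fst.fst).compl
    have h2 := Kernel.measurable_kernel_prodMk_left (κ := κ.comap Prod.snd measurable_snd) h1
    exact h2 (measurableSet_singleton 0)
  have hsol : MeasurableSet {p : E × (ℚ → ℝ) | IsSolutionPathLaw A Φ S (κ p.2)} :=
    measurable_snd (measurableSet_isSolutionPathLaw hΦ hSc κ)
  have hev : Measurable fun ω : ℚ≥0 → E => ω 0 := measurable_pi_apply 0
  refine measurable_of_measurableSet_relation (hsol.inter hset) κ.measurable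
    (fun x => ?_) fun x w hw => ?_
  · obtain ⟨w, hw⟩ := hsurj (pathLaw h x) inferInstance
    have h1 : IsSolutionPathLaw A Φ S (κ w) := by
      rw [hw]
      exact isSolutionPathLaw_pathLaw hΦ h S x
    have h2 : κ w {ω | ω 0 ≠ x} = 0 := by
      rw [hw]
      exact (map_eq_dirac_iff hev x).1 (pathLaw_map_zero h x)
    exact ⟨w, h1, h2⟩
  · have h1 : IsSolutionPathLaw A Φ S (κ w) := hw.1
    have h2 : κ w {ω | ω 0 ≠ x} = 0 := hw.2
    have h3 : (κ w).map (fun ω => ω 0) = Measure.dirac x := (map_eq_dirac_iff hev x).2 h2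
    exact pathLaw_unique hΦ hA1 h hS h1 h3

/-- The laws of the solutions started at deterministic points, as a kernel. -/
noncomputable def pathKernel (hΦ : Measurable Φ) (hA1 : Dominated A Φ)
    (hA2 : CountablyBPGenerated A Φ) (h : DegenerateWellPosed A Φ) : Kernel E (ℚ≥0 → E) :=
  ⟨pathLaw h, measurable_pathLaw hΦ hA1 hA2 h⟩

instance isMarkovKernel_pathKernel (hΦ : Measurable Φ) (hA1 : Dominated A Φ)
    (hA2 : CountablyBPGenerated A Φ) (h : DegenerateWellPosed A Φ) :
    IsMarkovKernel (pathKernel hΦ hA1 hA2 h) := ⟨isProbabilityMeasure_pathLaw h⟩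

theorem degLaw_eq_map (h : DegenerateWellPosed A Φ) (x : E) (m : ℕ) (t : Fin m → ℝ≥0) :
    degLaw h x m t = (pathLaw h x).map fun ω i => canonProcess (pathLaw h x) (t i) ω := by
  rw [← fdd_pathLaw]
  rfl

instance isProbabilityMeasure_degLaw (h : DegenerateWellPosed A Φ) (x : E) (m : ℕ)
    (t : Fin m → ℝ≥0) : IsProbabilityMeasure (degLaw h x m t) := by
  rw [degLaw_eq_map]
  exact Measure.isProbabilityMeasure_map (measurable_pi_lambda _ fun i =>
    (measurableProcess_canonProcess _).measurable (t i)).aemeasurable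

theorem measurable_canonProcess_pi {W : Type*} [MeasurableSpace W] (κ : Kernel W (ℚ≥0 → E)) {m : ℕ}
    (t : Fin m → ℝ≥0) : Measurable fun p : W × (ℚ≥0 → E) =>
      fun i => canonProcess (κ p.1) (t i) p.2 :=
  measurable_pi_lambda _ fun i => measurable_canonProcess_kernel_apply κ (t i)

theorem measurable_degLaw (hΦ : Measurable Φ) (hA1 : Dominated A Φ)
    (hA2 : CountablyBPGenerated A Φ) (h : DegenerateWellPosed A Φ) (m : ℕ) (t : Fin m → ℝ≥0) :
    Measurable fun x => degLaw h x m t := by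
  refine Measure.measurable_of_measurable_coe _ fun B hB => ?_
  have h1 : (fun x => degLaw h x m t B) = fun x => pathKernel hΦ hA1 hA2 h x
      (Prod.mk x ⁻¹' ((fun p : E × (ℚ≥0 → E) =>
        fun i => canonProcess (pathKernel hΦ hA1 hA2 h p.1) (t i) p.2) ⁻¹' B)) := by
    funext x
    rw [degLaw_eq_map, Measure.map_apply (measurable_pi_lambda _ fun i =>
      (measurableProcess_canonProcess _).measurable (t i)) hB]
    rfl
  rw [h1]
  exact Kernel.measurable_kernel_prodMk_left (measurable_canonProcess_pi _ t hB)

theorem lintegral_degLaw_one (h : DegenerateWellPosed A Φ) (x : E) (t : ℝ≥0) {g : E → ℝ≥0∞}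
    (hg : Measurable g) : ∫⁻ y, g (y 0) ∂(degLaw h x 1 fun _ => t) =
      ∫⁻ ω, g (canonProcess (pathLaw h x) t ω) ∂(pathLaw h x) := by
  have h0 : Measurable fun y : Fin 1 → E => g (y 0) := hg.comp (measurable_pi_apply 0)
  have h1 : Measurable fun (ω : ℚ≥0 → E) (_ : Fin 1) => canonProcess (pathLaw h x) t ω :=
    measurable_pi_lambda _ fun i => (measurableProcess_canonProcess _).measurable t
  rw [degLaw_eq_map, lintegral_map h0 h1]

theorem phiStar_eq_lintegral (hΦ : Measurable Φ) (h : DegenerateWellPosed A Φ) (N : ℕ) (x : E) :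
    phiStar h N x = ∫⁻ ω, (∫⁻ s in Set.Ioc (0 : ℝ) (N : ℝ),
      (Φ (canonProcess (pathLaw h x) s.toNNReal ω) : ℝ≥0∞)) ∂(pathLaw h x) := by
  unfold phiStar
  simp_rw [lintegral_degLaw_one h x _ hΦ.coe_nnreal_ennreal]
  refine (lintegral_lintegral_swap ?_).symm
  exact (hΦ.comp (measurableProcess_canonProcess
    (pathLaw h x)).measurable_uncurry_real).coe_nnreal_ennreal.aemeasurable

theorem measurable_phiStar (hΦ : Measurable Φ) (hA1 : Dominated A Φ)
    (hA2 : CountablyBPGenerated A Φ) (h : DegenerateWellPosed A Φ) (N : ℕ) :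
    Measurable (phiStar h N) := by
  have h1 := measurable_lintegral_canonProcess_kernel hΦ (pathKernel hΦ hA1 hA2 h) (N : ℝ)
  rw [funext (phiStar_eq_lintegral hΦ h N)]
  exact h1

/-- Finiteness at every single point comes from the solution started there; it lets sublevel sets
exhaust `E`. -/
theorem phiStar_lt_top (hΦ : Measurable Φ) (h : DegenerateWellPosed A Φ) (N : ℕ) (x : E) :
    phiStar h N x < ∞ := by
  rw [phiStar_eq_lintegral hΦ]
  exact (isSolutionPathLaw_pathLaw hΦ h ∅ x).integrable N

end DegenerateLaws

/-! ### The mixture of the solutions as a solution -/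

section Mixture

variable {E : Type u} [MetricSpace E] [MeasurableSpace E] [BorelSpace E]
  [SecondCountableTopology E] [CompleteSpace E] [Nonempty E] {A : MPOperator E} {Φ : E → ℝ≥0}

/-- The process on `E × (ℚ≥0 → E)` that follows the canonical process of `κ x` on the fibre
over `x`. -/
noncomputable def fibreProcess (κ : Kernel E (ℚ≥0 → E)) (t : ℝ≥0) (p : E × (ℚ≥0 → E)) : E :=
  canonProcess (κ p.1) t p.2

theorem measurableProcess_fibreProcess (κ : Kernel E (ℚ≥0 → E)) :
    MeasurableProcess (fibreProcess κ) := by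
  have h' := (measurable_canonProcess_kernel κ).comp
    (measurable_swap : Measurable (Prod.swap : ℝ≥0 × E × (ℚ≥0 → E) → _))
  exact h'

/-- On the fibre over `x` the process and its time integrals are those of `canonProcess (κ x)`, so
sections of past events are past events. -/
theorem measurableSet_fibre_starFiltration (κ : Kernel E (ℚ≥0 → E)) (x : E) (t : ℝ≥0)
    {F : Set (E × (ℚ≥0 → E))}
    (hF : MeasurableSet[starFiltration (fibreProcess κ) (measurableProcess_fibreProcess κ) t] F) :
    MeasurableSet[starFiltration (canonProcess (κ x)) (measurableProcess_canonProcess (κ x)) t]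
      (Prod.mk x ⁻¹' F) := by
  have hX := measurableProcess_canonProcess (κ x)
  have hle : starFiltration (fibreProcess κ) (measurableProcess_fibreProcess κ) t ≤
      MeasurableSpace.map (Prod.mk x) (starFiltration (canonProcess (κ x)) hX t) :=
    starFiltration_le_of_measurable _
      (fun u hu B hB => measurable_starFiltration hX hu hB)
      fun u hu h B hB => ((measurable_timeIntegral_starFiltration hX h.continuous.measurable u).mono
        ((starFiltration (canonProcess (κ x)) hX).mono hu) le_rfl) hB
  exact hle F hF

variable (hΦ : Measurable Φ) (hA1 : Dominated A Φ) (hA2 : CountablyBPGenerated A Φ)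
  (h : DegenerateWellPosed A Φ) (lam : Measure E) [IsProbabilityMeasure lam]

theorem fdd_fibreProcess :
    fdd (lam ⊗ₘ pathKernel hΦ hA1 hA2 h) (fibreProcess (pathKernel hΦ hA1 hA2 h)) =
      mixture h lam := by
  funext m t
  ext B hB
  have hm : Measurable fun (p : E × (ℚ≥0 → E)) (i : Fin m) =>
      fibreProcess (pathKernel hΦ hA1 hA2 h) (t i) p := measurable_canonProcess_pi _ t
  rw [fdd, mixture, Measure.map_apply hm hB, Measure.compProd_apply (hm hB),
    Measure.bind_apply hB (measurable_degLaw hΦ hA1 hA2 h m t).aemeasurable]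
  refine lintegral_congr fun x => ?_
  rw [degLaw_eq_map, Measure.map_apply (measurable_pi_lambda _ fun i =>
      (measurableProcess_canonProcess _).measurable (t i)) hB]
  rfl

theorem lintegral_fibreProcess (N : ℕ) :
    ∫⁻ p, (∫⁻ s in Set.Ioc (0 : ℝ) (N : ℝ),
      (Φ (fibreProcess (pathKernel hΦ hA1 hA2 h) s.toNNReal p) : ℝ≥0∞))
        ∂(lam ⊗ₘ pathKernel hΦ hA1 hA2 h) = ∫⁻ x, phiStar h N x ∂lam := by
  have hX := measurableProcess_fibreProcess (pathKernel hΦ hA1 hA2 h)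
  have hm : Measurable fun p : E × (ℚ≥0 → E) => ∫⁻ s in Set.Ioc (0 : ℝ) (N : ℝ),
      (Φ (fibreProcess (pathKernel hΦ hA1 hA2 h) s.toNNReal p) : ℝ≥0∞) :=
    (hΦ.comp hX.measurable_uncurry_real).coe_nnreal_ennreal.lintegral_prod_right'
  rw [Measure.lintegral_compProd hm]
  refine lintegral_congr fun x => ?_
  rw [phiStar_eq_lintegral hΦ]
  rfl

/-- Each defining property is integrated over the fibres: the martingale identity holds on every
section of a past event, and continuity in probability follows by dominated convergence because
`probDist` is at most 1. -/
theorem isContSolution_fibreProcess (hlam : ∀ N : ℕ, 1 ≤ N → ∫⁻ x, phiStar h N x ∂lam < ∞) :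
    IsContSolution A Φ lam (lam ⊗ₘ pathKernel hΦ hA1 hA2 h)
      (fibreProcess (pathKernel hΦ hA1 hA2 h)) := by
  have hX := measurableProcess_fibreProcess (pathKernel hΦ hA1 hA2 h)
  have hsol := isContSolution_pathLaw hΦ hA1 h
  have hI : ExpectedIntegralFinite Φ (lam ⊗ₘ pathKernel hΦ hA1 hA2 h)
      (fibreProcess (pathKernel hΦ hA1 hA2 h)) := by
    refine expectedIntegralFinite_of_nat fun N => ?_
    rcases Nat.eq_zero_or_pos N with rfl | hN
    · simp
    · exact (lintegral_fibreProcess hΦ hA1 hA2 h lam N).trans_lt (hlam N hN)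
  refine ⟨isSolution_of_setIntegral_eq hΦ hA1 hX ?_ hI fun f s t hst F hF => ?_, fun t => ?_⟩
  · ext B hB
    rw [Measure.map_apply (hX.measurable 0) hB, Measure.compProd_apply (hX.measurable 0 hB),
      ← lintegral_indicator_one hB]
    refine lintegral_congr fun x => ?_
    have h1 := (hsol x).1.law_zero
    rw [← Measure.dirac_apply' x hB, ← h1,
      Measure.map_apply ((hsol x).1.measurable.measurable 0) hB]
    rfl
  · obtain ⟨C, hC⟩ := hA1 f
    have hFm : MeasurableSet F := (starFiltration _ hX).le s F hF
    have key : ∀ r, ∫ p in F, compensated (f : E →ᵇ ℝ) (A.toFun f)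
        (fibreProcess (pathKernel hΦ hA1 hA2 h)) r p ∂(lam ⊗ₘ pathKernel hΦ hA1 hA2 h) =
        ∫ x, ∫ ω in Prod.mk x ⁻¹' F, compensated (f : E →ᵇ ℝ) (A.toFun f)
          (canonProcess (pathLaw h x)) r ω ∂(pathLaw h x) ∂lam := by
      intro r
      have hint := integrable_compensated hΦ hX hI (f : E →ᵇ ℝ).continuous.measurable
        (abs_apply_le_norm _) (A.measurable_toFun f) hC r
      rw [← integral_indicator hFm, Measure.integral_compProd (hint.indicator hFm)]
      refine integral_congr_ae (Eventually.of_forall fun x => ?_)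
      simp only
      rw [← integral_indicator (measurable_prodMk_left hFm)]
      rfl
    rw [key, key]
    refine integral_congr_ae (Eventually.of_forall fun x => ?_)
    exact (hsol x).1.setIntegral_eq f hst
      (measurableSet_fibre_starFiltration (pathKernel hΦ hA1 hA2 h) x s hF)
  · rw [tendstoInMeasure_iff_probDist _ hX.measurable (hX.measurable t)]
    have hm := fun s => measurable_min_edist (hX.measurable s) (hX.measurable t)
    have h1 : ∀ s, probDist (lam ⊗ₘ pathKernel hΦ hA1 hA2 h)
        (fibreProcess (pathKernel hΦ hA1 hA2 h) s) (fibreProcess (pathKernel hΦ hA1 hA2 h) t) =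
        ∫⁻ x, probDist (pathLaw h x) (canonProcess (pathLaw h x) s)
          (canonProcess (pathLaw h x) t) ∂lam := fun s => Measure.lintegral_compProd (hm s)
    simp_rw [h1]
    have h2 := tendsto_lintegral_filter_of_dominated_convergence (μ := lam) (l := 𝓝 t)
      (F := fun s x => probDist (pathLaw h x) (canonProcess (pathLaw h x) s)
          (canonProcess (pathLaw h x) t)) (f := fun _ => 0) (fun _ => 1)
      (Eventually.of_forall fun s => (hm s).lintegral_kernel_prod_right'
        (κ := pathKernel hΦ hA1 hA2 h))
      (Eventually.of_forall fun s => Eventually.of_forall fun x => probDist_le_one _ _ _)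
      (by simp) (Eventually.of_forall fun x => ?_)
    · simpa using h2
    · have hx := (hsol x).1.measurable.measurable
      exact (tendstoInMeasure_iff_probDist _ hx (hx t)).1 ((hsol x).2 t)

end Mixture


/-- Countably many finite measurable functions are simultaneously bounded on a set whose
complement has small measure. -/
theorem exists_measurableSet_forall_bounded {α : Type*} [MeasurableSpace α] (μ : Measure α)
    [IsFiniteMeasure μ] {ι : Type*} [Countable ι] {g : ι → α → ℝ≥0∞} (hg : ∀ i, Measurable (g i))
    (hfin : ∀ i x, g i x < ∞) {ε : ℝ≥0∞} (hε : ε ≠ 0) :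
    ∃ B, MeasurableSet B ∧ μ Bᶜ ≤ ε ∧ ∀ i, ∃ c : ℕ, ∀ x ∈ B, g i x ≤ c := by
  -- The `i`-th bound may fail on a set of measure at most `δ i`, and these sum to less than `ε`.
  obtain ⟨δ, hδ, hsum⟩ := ENNReal.exists_pos_sum_of_countable' hε ι
  have hm : ∀ i (c : ℕ), MeasurableSet {x | (c : ℝ≥0∞) < g i x} := fun i c =>
    measurableSet_lt measurable_const (hg i)
  have hc : ∀ i, ∃ c : ℕ, μ {x | (c : ℝ≥0∞) < g i x} ≤ δ i := by
    intro i
    have hanti : Antitone fun c : ℕ => {x | (c : ℝ≥0∞) < g i x} := fun c d hcd x hx =>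
      lt_of_le_of_lt (Nat.cast_le.2 hcd) (show (d : ℝ≥0∞) < g i x from hx)
    have hlim := tendsto_measure_iInter_atTop (μ := μ) (fun c => (hm i c).nullMeasurableSet) hanti
      ⟨0, measure_ne_top _ _⟩
    have hempty : ⋂ c : ℕ, {x | (c : ℝ≥0∞) < g i x} = ∅ := by
      ext x
      obtain ⟨c, hc⟩ := ENNReal.exists_nat_gt (hfin i x).ne
      simpa using ⟨c, hc.le⟩
    rw [hempty, measure_empty] at hlim
    exact (hlim.eventually_le_const (hδ i)).exists
  choose c hc using hc
  refine ⟨⋂ i, {x | (c i : ℝ≥0∞) < g i x}ᶜ, MeasurableSet.iInter fun i => (hm i _).compl, ?_,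
    fun i => ⟨c i, fun x hx => ?_⟩⟩
  · simp only [Set.compl_iInter, compl_compl]
    exact (measure_iUnion_le _).trans ((ENNReal.tsum_le_tsum hc).trans hsum.le)
  · have := Set.mem_iInter.1 hx i
    exact not_lt.1 this

theorem lintegral_cond_lt_top {α : Type*} [MeasurableSpace α] {μ : Measure α} [IsFiniteMeasure μ]
    {B : Set α} (hB : MeasurableSet B) (hμB : μ B ≠ 0) {g : α → ℝ≥0∞} {c : ℕ}
    (hc : ∀ x ∈ B, g x ≤ c) : ∫⁻ x, g x ∂μ[|B] < ∞ := by
  rw [ProbabilityTheory.cond, lintegral_smul_measure, smul_eq_mul]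
  refine ENNReal.mul_lt_top (ENNReal.inv_lt_top.2 (pos_iff_ne_zero.2 hμB)) ?_
  refine (setLIntegral_mono' hB hc).trans_lt ?_
  rw [setLIntegral_const]
  exact ENNReal.mul_lt_top (ENNReal.natCast_lt_top c) (measure_lt_top _ _)

/-! ### Quantities determined by the finite-dimensional distributions -/

section Laws

variable {E : Type u} [MeasurableSpace E] {Φ : E → ℝ≥0} {Ω : Type u} [MeasurableSpace Ω]
  {P : Measure Ω} {X : ℝ≥0 → Ω → E}

theorem map_cond_preimage {Y : Ω → E} (hY : Measurable Y) {B : Set E} (hB : MeasurableSet B) :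
    P[|Y ⁻¹' B].map Y = (P.map Y)[|B] := by
  ext D hD
  rw [Measure.map_apply hY hD, cond_apply (hY hB), cond_apply hB, Measure.map_apply hY hB,
    Measure.map_apply hY (hB.inter hD)]
  rfl

theorem lintegral_eq_lintegral_fdd [SFinite P] (hΦ : Measurable Φ)
    (hX : MeasurableProcess X) (N : ℕ) :
    ∫⁻ ω, (∫⁻ s in Set.Ioc (0 : ℝ) (N : ℝ), (Φ (X s.toNNReal ω) : ℝ≥0∞)) ∂P =
      ∫⁻ s in Set.Ioc (0 : ℝ) (N : ℝ), ∫⁻ y, (Φ (y 0) : ℝ≥0∞)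
        ∂(fdd P X 1 fun _ => s.toNNReal) := by
  rw [lintegral_lintegral_swap
    (hΦ.comp hX.measurable_uncurry_real).coe_nnreal_ennreal.aemeasurable]
  refine lintegral_congr fun s => ?_
  have h0 : Measurable fun y : Fin 1 → E => (Φ (y 0) : ℝ≥0∞) :=
    (hΦ.comp (measurable_pi_apply 0)).coe_nnreal_ennreal
  have h1 : Measurable fun (ω : Ω) (_ : Fin 1) => X s.toNNReal ω :=
    measurable_pi_lambda _ fun i => hX.measurable _
  rw [fdd, lintegral_map h0 h1]

theorem integral_fdd_one (hX : MeasurableProcess X) {f : E → ℝ} (hf : Measurable f) (t : ℝ≥0) :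
    ∫ y, f (y 0) ∂(fdd P X 1 fun _ => t) = ∫ ω, f (X t ω) ∂P := by
  have h0 : Measurable fun y : Fin 1 → E => f (y 0) := hf.comp (measurable_pi_apply 0)
  have h1 : Measurable fun (ω : Ω) (_ : Fin 1) => X t ω :=
    measurable_pi_lambda _ fun i => hX.measurable _
  rw [fdd, integral_map h1.aemeasurable h0.aestronglyMeasurable]

end Laws

/-! ### Uniqueness, integrability of the initial law, and the Markov property -/

section Main

variable {E : Type u} [MetricSpace E] [MeasurableSpace E] [BorelSpace E]
  {A : MPOperator E} {Φ : E → ℝ≥0} {Ω : Type u} [MeasurableSpace Ω] {P : Measure Ω}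
  [IsProbabilityMeasure P] {X : ℝ≥0 → Ω → E} {lam : Measure E}
  [SecondCountableTopology E] [CompleteSpace E] [Nonempty E]

/-- The finite-dimensional distributions of any solution that is continuous in probability are
mixtures of those of the solutions started at deterministic points. -/
theorem IsContSolution.fdd_eq_mixture (hΦ : Measurable Φ) (hA1 : Dominated A Φ)
    (hA2 : CountablyBPGenerated A Φ) (h : DegenerateWellPosed A Φ)
    (hA6 : UniqueUnderIntegrability A Φ) (hX : IsContSolution A Φ lam P X) :
    fdd P X = mixture h lam := by
  have hm := hX.1.measurable.measurable
  have hlam : IsProbabilityMeasure lam := by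
    rw [← hX.1.law_zero]
    exact Measure.isProbabilityMeasure_map (hm 0).aemeasurable
  obtain ⟨H, hH, hu⟩ := hA6
  -- Bounding the first family makes (A6) applicable to `lam[|B]`; bounding the second makes the
  -- mixture over `lam[|B]` a solution.
  let g : ℕ ⊕ ℕ → E → ℝ≥0∞ := Sum.elim (fun n x => (H n x : ℝ≥0∞)) (phiStar h)
  have hg : ∀ i, Measurable (g i) := by
    rintro (n | N)
    · exact (hH n).coe_nnreal_ennreal
    · exact measurable_phiStar hΦ hA1 hA2 h N
  have hgfin : ∀ i x, g i x < ∞ := by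
    rintro (n | N) x
    · exact ENNReal.coe_lt_top
    · exact phiStar_lt_top hΦ h N x
  funext m t
  have hmt : Measurable fun ω i => X (t i) ω := measurable_pi_lambda _ fun i => hm (t i)
  have hp1 : IsProbabilityMeasure (fdd P X m t) :=
    Measure.isProbabilityMeasure_map hmt.aemeasurable
  have hp2 : IsProbabilityMeasure (mixture h lam m t) := by
    rw [← fdd_fibreProcess hΦ hA1 hA2 h lam]
    exact Measure.isProbabilityMeasure_map (measurable_canonProcess_pi _ t).aemeasurable
  -- Two probability measures with one below the other coincide, so a one-sided estimate with error
  -- `ε` is enough.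
  refine Measure.eq_of_le_of_isProbabilityMeasure (Measure.le_iff.2 fun C hC => ?_)
  refine ENNReal.le_of_forall_pos_le_add fun ε hε _ => ?_
  obtain ⟨B, hB, hBε, hbd⟩ := exists_measurableSet_forall_bounded lam hg hgfin
    (ENNReal.coe_ne_zero.2 hε.ne')
  by_cases hB0 : lam B = 0
  · have h1 : lam Bᶜ = 1 := (prob_compl_eq_one_iff hB).2 hB0
    exact prob_le_one.trans ((h1.symm.le.trans hBε).trans le_add_self)
  have hPB : P (X 0 ⁻¹' B) = lam B := by
    rw [← hX.1.law_zero, Measure.map_apply (hm 0) hB]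
  have hPB0 : P (X 0 ⁻¹' B) ≠ 0 := by rwa [hPB]
  have hprob : IsProbabilityMeasure P[|X 0 ⁻¹' B] := cond_isProbabilityMeasure hPB0
  have hprob' : IsProbabilityMeasure lam[|B] := cond_isProbabilityMeasure hB0
  -- With shift 0 this is pure conditioning on `X 0 ∈ B`, which replaces the initial law by
  -- `lam[|B]`.
  have hsol := hX.shift_cond hΦ hA1 0
    (measurable_starFiltration hX.1.measurable le_rfl hB) hPB0
  rw [map_cond_preimage (hm 0) hB, hX.1.law_zero] at hsol
  simp only [zero_add] at hsol
  have hfib := isContSolution_fibreProcess hΦ hA1 hA2 h lam[|B] fun N _ =>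
    lintegral_cond_lt_top hB hB0 (hbd (Sum.inr N)).choose_spec
  have hfdd := hu lam[|B] (fun n => lintegral_cond_lt_top hB hB0 (hbd (Sum.inl n)).choose_spec)
    _ _ _ _ _ _ hsol hfib
  rw [fdd_fibreProcess] at hfdd
  have hfdd' : P[|X 0 ⁻¹' B].map (fun ω i => X (t i) ω) C = mixture h lam[|B] m t C := by
    rw [← hfdd]
    rfl
  have hdm := (measurable_degLaw hΦ hA1 hA2 h m t).aemeasurable (μ := lam)
  have hdm' := (measurable_degLaw hΦ hA1 hA2 h m t).aemeasurable (μ := lam[|B])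
  rw [Measure.map_apply hmt hC, cond_apply (hm 0 hB), hPB, mixture, Measure.bind_apply hC hdm',
    ProbabilityTheory.cond, lintegral_smul_measure, smul_eq_mul] at hfdd'
  -- Cancelling the common normalization turns equality of the conditional laws into equality on the
  -- event `X 0 ∈ B`.
  have hinter : P (X 0 ⁻¹' B ∩ (fun ω i => X (t i) ω) ⁻¹' C) =
      ∫⁻ x in B, degLaw h x m t C ∂lam :=
    (ENNReal.mul_right_inj (ENNReal.inv_ne_zero.2 (measure_ne_top _ _))
      (ENNReal.inv_ne_top.2 hB0)).1 hfdd'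
  calc fdd P X m t C = P ((fun ω i => X (t i) ω) ⁻¹' C) := Measure.map_apply hmt hC
    _ ≤ P (X 0 ⁻¹' B ∩ (fun ω i => X (t i) ω) ⁻¹' C) + P (X 0 ⁻¹' Bᶜ) := by
        refine (measure_mono fun ω hω => ?_).trans (measure_union_le _ _)
        by_cases hωB : X 0 ω ∈ B
        · exact Or.inl ⟨hωB, hω⟩
        · exact Or.inr hωB
    _ ≤ mixture h lam m t C + ε := by
        refine add_le_add ?_ ?_
        · rw [hinter, mixture, Measure.bind_apply hC hdm]
          exact setLIntegral_le_lintegral _ _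
        · rw [← Measure.map_apply (hm 0) hB.compl, hX.1.law_zero]
          exact hBε

/-- The expected integral of `Φ` depends only on the one-dimensional distributions, which `X` shares
with the fibre process. The latter is defined, and its distributions are known, before it is known
to be a solution. -/
theorem IsContSolution.lintegral_phiStar_lt_top (hΦ : Measurable Φ) (hA1 : Dominated A Φ)
    (hA2 : CountablyBPGenerated A Φ) (h : DegenerateWellPosed A Φ)
    (hA6 : UniqueUnderIntegrability A Φ) (hX : IsContSolution A Φ lam P X)
    [IsProbabilityMeasure lam] (N : ℕ) : ∫⁻ x, phiStar h N x ∂lam < ∞ := by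
  rw [← lintegral_fibreProcess hΦ hA1 hA2 h lam N,
    lintegral_eq_lintegral_fdd hΦ (measurableProcess_fibreProcess _), fdd_fibreProcess,
    ← hX.fdd_eq_mixture hΦ hA1 hA2 h hA6, ← lintegral_eq_lintegral_fdd hΦ hX.1.measurable]
  exact_mod_cast hX.1.integrable N

theorem semigroupOp_eq_integral (h : DegenerateWellPosed A Φ) {f : E → ℝ} (hf : Measurable f)
    (t : ℝ≥0) (x : E) : semigroupOp h t f x =
      ∫ ω, f (canonProcess (pathLaw h x) t ω) ∂(pathLaw h x) := by
  rw [semigroupOp, ← fdd_pathLaw, integral_fdd_one (measurableProcess_canonProcess _) hf]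

theorem measurable_semigroupOp (hΦ : Measurable Φ) (hA1 : Dominated A Φ)
    (hA2 : CountablyBPGenerated A Φ) (h : DegenerateWellPosed A Φ) {f : E → ℝ}
    (hf : Measurable f) (t : ℝ≥0) : Measurable (semigroupOp h t f) :=
  measurable_integral_measure (measurable_degLaw hΦ hA1 hA2 h 1 fun _ => t)
    (hf.comp (measurable_pi_apply 0))

theorem abs_semigroupOp_le (h : DegenerateWellPosed A Φ) {f : E → ℝ} {K : ℝ}
    (hK : ∀ x, |f x| ≤ K) (t : ℝ≥0) (x : E) : |semigroupOp h t f x| ≤ K := by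
  have := norm_integral_le_of_norm_le_const (μ := degLaw h x 1 fun _ => t)
    (f := fun y => f (y 0)) (C := K) (Eventually.of_forall fun y => hK _)
  simpa [semigroupOp] using this

theorem IsContSolution.integral_eq_semigroupOp (hΦ : Measurable Φ) (hA1 : Dominated A Φ)
    (hA2 : CountablyBPGenerated A Φ) (h : DegenerateWellPosed A Φ)
    (hA6 : UniqueUnderIntegrability A Φ) (hX : IsContSolution A Φ lam P X)
    [IsProbabilityMeasure lam] {f : E → ℝ} (hf : Measurable f) {K : ℝ} (hK : ∀ x, |f x| ≤ K)
    (t : ℝ≥0) : ∫ ω, f (X t ω) ∂P = ∫ x, semigroupOp h t f x ∂lam := by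
  have hY := measurableProcess_fibreProcess (pathKernel hΦ hA1 hA2 h)
  rw [← integral_fdd_one hX.1.measurable hf, hX.fdd_eq_mixture hΦ hA1 hA2 h hA6,
    ← fdd_fibreProcess hΦ hA1 hA2 h lam, integral_fdd_one hY hf,
    Measure.integral_compProd (integrable_comp_of_bounded hf hK (hY.measurable t))]
  simp_rw [semigroupOp_eq_integral h hf]
  rfl

/-- Given `F`, the process restarted at `s` is a solution whose initial law is that of `X s` given
`F`. Its mean of `f` at time `t` is the average of `T_t f` over that law, as the mixture formula
holds for every solution. -/
theorem IsContSolution.setIntegral_markov (hΦ : Measurable Φ) (hA1 : Dominated A Φ)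
    (hA2 : CountablyBPGenerated A Φ) (h : DegenerateWellPosed A Φ)
    (hA6 : UniqueUnderIntegrability A Φ) (hX : IsContSolution A Φ lam P X)
    {f : E → ℝ} (hf : Measurable f) {K : ℝ} (hK : ∀ x, |f x| ≤ K) (s t : ℝ≥0) {F : Set Ω}
    (hF : MeasurableSet[starFiltration X hX.1.measurable s] F) :
    ∫ ω in F, semigroupOp h t f (X s ω) ∂P = ∫ ω in F, f (X (s + t) ω) ∂P := by
  by_cases hPF : P F = 0
  · rw [setIntegral_measure_zero _ hPF, setIntegral_measure_zero _ hPF]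
  have hm := hX.1.measurable.measurable
  have hprob : IsProbabilityMeasure P[|F] := cond_isProbabilityMeasure hPF
  have hprob' : IsProbabilityMeasure (P[|F].map (X s)) :=
    Measure.isProbabilityMeasure_map (hm s).aemeasurable
  have h1 := (hX.shift_cond hΦ hA1 s hF hPF).integral_eq_semigroupOp hΦ hA1 hA2 h hA6 hf hK t
  rw [integral_map (hm s).aemeasurable
    (measurable_semigroupOp hΦ hA1 hA2 h hf t).aestronglyMeasurable, ProbabilityTheory.cond,
    integral_smul_measure, integral_smul_measure] at h1
  have hne : ((P F)⁻¹).toReal ≠ 0 :=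
    (ENNReal.toReal_pos (ENNReal.inv_ne_zero.2 (measure_ne_top _ _))
      (ENNReal.inv_ne_top.2 hPF)).ne'
  exact (smul_right_injective ℝ hne h1).symm

theorem IsContSolution.isMarkovWith (hΦ : Measurable Φ) (hA1 : Dominated A Φ)
    (hA2 : CountablyBPGenerated A Φ) (h : DegenerateWellPosed A Φ)
    (hA6 : UniqueUnderIntegrability A Φ) (hX : IsContSolution A Φ lam P X) :
    IsMarkovWith P X (semigroupOp h) := by
  rintro s t f hf ⟨K, hK⟩
  have hm := hX.1.measurable.measurable
  have hle : (⨆ v ≤ s, MeasurableSpace.comap (X v) inferInstance) ≤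
      starFiltration X hX.1.measurable s := le_sup_left
  have hTm := measurable_semigroupOp hΦ hA1 hA2 h hf t
  have hXs : Measurable[⨆ v ≤ s, MeasurableSpace.comap (X v) inferInstance] (X s) :=
    measurable_iff_comap_le.2 (le_iSup₂_of_le s le_rfl le_rfl)
  refine (ae_eq_condExp_of_forall_setIntegral_eq
    (hle.trans ((starFiltration X hX.1.measurable).le s))
    (integrable_comp_of_bounded hf hK (hm (s + t)))
    (fun F _ _ => (integrable_comp_of_bounded hTm (abs_semigroupOp_le h hK t)
      (hm s)).integrableOn)
    (fun F hF _ => hX.setIntegral_markov hΦ hA1 hA2 h hA6 hf hK s t (hle F hF))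
    (hTm.comp hXs).stronglyMeasurable.aestronglyMeasurable).symm

theorem semigroupOp_zero (hΦ : Measurable Φ) (hA1 : Dominated A Φ) (h : DegenerateWellPosed A Φ)
    {f : E → ℝ} (hf : Measurable f) : semigroupOp h 0 f = f := by
  funext x
  have hX := isContSolution_pathLaw hΦ hA1 h x
  rw [semigroupOp_eq_integral h hf, ← integral_map (hX.1.measurable.measurable 0).aemeasurable
    hf.aestronglyMeasurable, hX.1.law_zero, integral_dirac]

/-- The Markov identity for the solution started at `x`, taken on the whole space. -/
theorem semigroupOp_add (hΦ : Measurable Φ) (hA1 : Dominated A Φ)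
    (hA2 : CountablyBPGenerated A Φ) (h : DegenerateWellPosed A Φ)
    (hA6 : UniqueUnderIntegrability A Φ) {f : E → ℝ} (hf : Measurable f) {K : ℝ}
    (hK : ∀ x, |f x| ≤ K) (s t : ℝ≥0) :
    semigroupOp h (s + t) f = semigroupOp h s (semigroupOp h t f) := by
  funext x
  have hX := isContSolution_pathLaw hΦ hA1 h x
  have h1 := hX.setIntegral_markov hΦ hA1 hA2 h hA6 hf hK s t MeasurableSet.univ
  rw [semigroupOp_eq_integral h hf,
    semigroupOp_eq_integral h (measurable_semigroupOp hΦ hA1 hA2 h hf t)]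
  simpa using h1.symm

theorem isSemigroupOnBoundedBorel_semigroupOp (hΦ : Measurable Φ) (hA1 : Dominated A Φ)
    (hA2 : CountablyBPGenerated A Φ) (h : DegenerateWellPosed A Φ)
    (hA6 : UniqueUnderIntegrability A Φ) : IsSemigroupOnBoundedBorel (semigroupOp h) := by
  rintro f hf ⟨K, hK⟩
  exact ⟨fun t => ⟨measurable_semigroupOp hΦ hA1 hA2 h hf t, K, abs_semigroupOp_le h hK t⟩,
    semigroupOp_zero hΦ hA1 h hf, semigroupOp_add hΦ hA1 hA2 h hA6 hf hK⟩

theorem wellPosed_iff_mem_PPhi (hΦ : Measurable Φ) (hA1 : Dominated A Φ)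
    (hA2 : CountablyBPGenerated A Φ) (h : DegenerateWellPosed A Φ)
    (hA6 : UniqueUnderIntegrability A Φ) (lam : Measure E) [hlam : IsProbabilityMeasure lam] :
    WellPosed A Φ lam ↔ lam ∈ PPhi h := by
  constructor
  · rintro ⟨⟨Ω, i, P, hP, X, hX⟩, -⟩
    exact ⟨hlam, fun N _ => hX.lintegral_phiStar_lt_top hΦ hA1 hA2 h hA6 N⟩
  · rintro ⟨-, hN⟩
    refine ⟨⟨_, _, _, inferInstance, _, isContSolution_fibreProcess hΦ hA1 hA2 h lam hN⟩, ?_⟩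
    intro Ω Ω' _ _ P P' _ _ X X' hX hX'
    rw [hX.fdd_eq_mixture hΦ hA1 hA2 h hA6, hX'.fdd_eq_mixture hΦ hA1 hA2 h hA6]

end Main

theorem isEmpty_elim_probabilityMeasure {E : Type*} [MeasurableSpace E] [IsEmpty E]
    (lam : Measure E) [IsProbabilityMeasure lam] : False := by
  have h : lam Set.univ = 1 := measure_univ
  rw [Set.univ_eq_empty_iff.2 ‹_›, measure_empty] at h
  exact zero_ne_one h

end MartingaleProblem

theorem mainTheorem5 {E : Type u} [MetricSpace E] [CompleteSpace E] [SecondCountableTopology E]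
    [MeasurableSpace E] [BorelSpace E]
    (A : MPOperator E) (Φ : E → ℝ≥0) (hΦ : Measurable Φ)
    (hA1 : Dominated A Φ)
    (hA2 : CountablyBPGenerated A Φ)
    (hA3 : DegenerateWellPosed A Φ)
    (hA6 : UniqueUnderIntegrability A Φ) :
    -- measurability of `x ↦ μ_x` and of `Φ*_N`, which gives meaning to `𝒫_Φ` and to the mixtures
    (∀ (m : ℕ) (t : Fin m → ℝ≥0), Measurable fun x => degLaw hA3 x m t) ∧
    (∀ N : ℕ, Measurable (phiStar hA3 N)) ∧
    -- (i)
    (∀ (lam : Measure E) [IsProbabilityMeasure lam],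
      (WellPosed A Φ lam ↔ lam ∈ PPhi hA3)) ∧
    (∀ lam ∈ PPhi hA3, ∀ (Ω : Type u) [MeasurableSpace Ω] (P : Measure Ω)
      [IsProbabilityMeasure P] (Y : ℝ≥0 → Ω → E),
      IsContSolution A Φ lam P Y → fdd P Y = mixture hA3 lam) ∧
    -- (ii)
    IsSemigroupOnBoundedBorel (semigroupOp hA3) ∧
    (∀ lam ∈ PPhi hA3, ∀ (Ω : Type u) [MeasurableSpace Ω] (P : Measure Ω)
      [IsProbabilityMeasure P] (X : ℝ≥0 → Ω → E),
      IsContSolution A Φ lam P X → IsMarkovWith P X (semigroupOp hA3)) := by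
  -- The limits in `canonProcess` need a default point. On an empty space there are no probability
  -- measures, and functions on it are all equal and measurable.
  rcases isEmpty_or_nonempty E with hE | hE
  · refine ⟨fun m t => measurable_of_empty _, fun N => measurable_of_empty _,
      fun lam _ => (isEmpty_elim_probabilityMeasure lam).elim,
      fun lam hlam => ?_, fun f _ _ => ⟨fun t => ⟨measurable_of_empty _, 0, isEmptyElim⟩,
        Subsingleton.elim _ _, fun s t => Subsingleton.elim _ _⟩, fun lam hlam => ?_⟩ <;>
    · have := hlam.1
      exact (isEmpty_elim_probabilityMeasure lam).elim
  · exact ⟨measurable_degLaw hΦ hA1 hA2 hA3, measurable_phiStar hΦ hA1 hA2 hA3,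
      fun lam _ => wellPosed_iff_mem_PPhi hΦ hA1 hA2 hA3 hA6 lam,
      fun lam _ Ω _ P _ Y hY => hY.fdd_eq_mixture hΦ hA1 hA2 hA3 hA6,
      isSemigroupOnBoundedBorel_semigroupOp hΦ hA1 hA2 hA3 hA6,
      fun lam _ Ω _ P _ X hX => hX.isMarkovWith hΦ hA1 hA2 hA3 hA6⟩
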